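/- Consider on $\Omega=(0,1)$ the homogeneous fractional sub-diffusion problem $${}_0\partial_t^\alpha(u-u_0)+Au=0\ \text{ in }\Omega\times(0,T],\qquad u=0\ \text{ on }\partial\Omega\times(0,T],\qquad u(0)=u_0,$$ where $0<\alpha<1$, $T>0$, ${}_0\partial_t^\alpha g(t)=\frac1{\Gamma(1-\alpha)}\frac{d}{dt}\int_0^t(t-\xi)^{-\alpha}g(\xi)\,d\xi$ is the Riemann--Liouville derivative and $A=-\Delta$ with homogeneous Dirichlet boundary conditions, with eigenvalues $\lambda_k=k^2\pi^2$ and eigenfunctions $\phi_k(x)=\sqrt2\sin(k\pi x)$, $k\ge1$. For $\sigma\ge0$ let $\hat H^\sigma(\Omega)$ be the space of $v\in L^2(\Omega)$ with $\|v\|_{\hat H^\sigma(\Omega)}^2=\sum_{k\ge1}\lambda_k^\sigma(v,\phi_k)^2<\infty$, where $(\cdot,\cdot)$ is the inner product of $L^2(\Omega)$. A solution $u$ is understood as follows: $u\in C([0,T];L^2(\Omega))$ with $u(0)=u_0$; for each $t\in(0,T]$ the function $u(\cdot,t)$ is continuous on $[0,1]$ and vanishes at $0$ and $1$; and for every $\psi\in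 C^\infty([0,1])$ with $\psi(0)=\psi(1)=0$ and every $t\in(0,T]$ one has ${}_0\partial_t^\alpha(u-u_0,\psi)(t)=(u(t),\psi'')$. Let $N\ge2$ be an integer, $h=1/N$, $x_i=i/N$, and $P_Nu_0=\sum_{k=1}^{N-1}(u_0,\phi_k)\phi_k$. The modified central difference scheme asks for $\mathbf u_{h,p}=(u_{h,p,1},\dots,u_{h,p,N-1})\in C([0,T];\mathbb R^{N-1})$ with $u_{h,p,i}(0)=(P_Nu_0)(x_i)$ and $${}_0\partial_t^\alpha\bigl(u_{h,p,i}-(P_Nu_0)(x_i)\bigr)(t)+N^2\sum_{j=1}^{N-1}w_{i,j}u_{h,p,j}(t)=0,\qquad t\in(0,T],\ 1\le i\le N-1,$$ where $w_{i,i}=2$, $w_{i,j}=-1$ if $|i-j|=1$, and $w_{i,j}=0$ otherwise. Write $\mathbf u(t)=(u(x_1,t),\dots,u(x_{N-1},t))$, $\|\mathbf v\|_{l^\infty}=\max_{1\le k\le M}|v_k|$ and $\|\mathbf v\|_{l^2}^2=\frac1M\sum_{k=1}^Mv_k^2$ for $\mathbf v\in\mathbb R^M$, $\ell_h=|\ln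 h|^{1/2}$, and $\chi_0(x)=1$ if $x=0$, $\chi_0(x)=0$ if $x\ne0$. Theorem. Let $0<\alpha<1$ and $\sigma\ge0$. There is a constant $C>0$, depending only on $\alpha$ and $\sigma$, such that for all $T>0$, all $u_0\in\hat H^\sigma(\Omega)$, every integer $N\ge2$, and all solutions $u$ of the problem and $\mathbf u_{h,p}$ of the modified scheme, one has for every $t\in(0,T]$ $$\|\mathbf u(t)-\mathbf u_{h,p}(t)\|_{l^\infty}\le C\,h^{\min(\sigma+\frac32,2)}\,\ell_h^{\chi_0(\frac14-\frac\sigma2)}\,t^{-\alpha}\,\|u_0\|_{\hat H^\sigma(\Omega)}$$ and $$\|\mathbf u(t)-\mathbf u_{h,p}(t)\|_{l^2}\le C\,h^2\,t^{-\alpha}\,\|u_0\|_{\hat H^\sigma(\Omega)}.$$ -/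

import Mathlib

open MeasureTheory Set Filter Topology
open scoped ContDiff

noncomputable section

namespace FracDiff

/-- The eigenvalues `λ_k = k² π²` of `-Δ` on `(0,1)` with homogeneous Dirichlet conditions
(used for `k ≥ 1`). -/
def eigval (k : ℕ) : ℝ := (k : ℝ) ^ 2 * Real.pi ^ 2

/-- The eigenfunctions `φ_k(x) = √2 sin(kπx)` (used for `k ≥ 1`). -/
def eigfun (k : ℕ) (x : ℝ) : ℝ := Real.sqrt 2 * Real.sin ((k : ℝ) * Real.pi * x)

/-- The `L²(0,1)` pairing `(v, w)`. -/
def pairing (v w : ℝ → ℝ) : ℝ := ∫ x in (0 : ℝ)..1, v x * w x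

/-- `v ∈ L²(0,1)`. -/
def InL2 (v : ℝ → ℝ) : Prop := MemLp v 2 (volume.restrict (Ioo (0 : ℝ) 1))

/-- `v ∈ Ĥ^s(0,1)`: `v ∈ L²(0,1)` and `∑_{k ≥ 1} λ_k^s (v, φ_k)² < ∞`. -/
def InHhat (s : ℝ) (v : ℝ → ℝ) : Prop :=
  InL2 v ∧ Summable fun k : ℕ => eigval (k + 1) ^ s * pairing v (eigfun (k + 1)) ^ 2

/-- The norm of `Ĥ^s(0,1)`. -/
def hhatNorm (s : ℝ) (v : ℝ → ℝ) : ℝ :=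
  Real.sqrt (∑' k : ℕ, eigval (k + 1) ^ s * pairing v (eigfun (k + 1)) ^ 2)

/-- The function `t ↦ (1/Γ(1-α)) ∫₀ᵗ (t-ξ)^{-α} g(ξ) dξ`, whose derivative is the
Riemann-Liouville derivative of order `α` of `g`. -/
def rlPrimitive (α : ℝ) (g : ℝ → ℝ) (t : ℝ) : ℝ :=
  1 / Real.Gamma (1 - α) * ∫ ξ in (0 : ℝ)..t, (t - ξ) ^ (-α) * g ξ

/-- The Riemann-Liouville derivative of order `α` of `g : [0,T] → ℝ` exists at `t ∈ [0,T]` and has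
the value `d` (the derivative is one-sided at `t = T`). -/
def HasRLDeriv (α T : ℝ) (g : ℝ → ℝ) (d t : ℝ) : Prop :=
  HasDerivWithinAt (rlPrimitive α g) d (Icc 0 T) t

/-- `u` (with `u t x` its value at time `t` and position `x`) is a solution on `(0,1) × (0,T]` of
`∂_t^α (u - u₀) + A u = f`, `u = 0` on the boundary, `u(0) = u₀`, where `A = -Δ` with homogeneous
Dirichlet conditions. The solution is continuous in time with values in `L²(0,1)`, at positive times
it is continuous on `[0,1]` (so that it has nodal values) and vanishes at both ends, and the equation
holds at every time `t ∈ (0,T]` when it is tested with smooth functions `ψ` that vanish at the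
ends, `A` being moved to the test function. -/
structure IsSolution (α T : ℝ) (u₀ : ℝ → ℝ) (f u : ℝ → ℝ → ℝ) : Prop where
  memL2 : ∀ t ∈ Icc 0 T, InL2 (u t)
  continuous_time : ∀ s ∈ Icc 0 T,
    Tendsto (fun t => eLpNorm (fun x => u t x - u s x) 2 (volume.restrict (Ioo (0 : ℝ) 1)))
      (𝓝[Icc 0 T] s) (𝓝 0)
  initial : u 0 =ᵐ[volume.restrict (Ioo (0 : ℝ) 1)] u₀
  continuous_space : ∀ t ∈ Ioc 0 T, ContinuousOn (u t) (Icc 0 1)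
  boundary : ∀ t ∈ Ioc 0 T, u t 0 = 0 ∧ u t 1 = 0
  equation : ∀ ψ : ℝ → ℝ, ContDiff ℝ ∞ ψ → ψ 0 = 0 → ψ 1 = 0 → ∀ t ∈ Ioc 0 T,
    HasRLDeriv α T (fun s => pairing (fun x => u s x - u₀ x) ψ)
      (pairing (f t) ψ - pairing (u t) (fun x => -deriv (deriv ψ) x)) t

/-- The vector of values of `v` at the interior nodes `x_i = i/N`, `i = 1, …, N-1`
(the index `i : Fin (N-1)` stands for the node `x_{i+1}`). -/
def nodal (N : ℕ) (v : ℝ → ℝ) : Fin (N - 1) → ℝ :=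
  fun i => v (((i : ℕ) + 1 : ℝ) / (N : ℝ))

/-- The central difference matrix `N² w_{i,j}`, with `w_{i,j} = 2` for `i = j`, `-1` for
`|i - j| = 1` and `0` otherwise. -/
def diffMatrix (N : ℕ) : Matrix (Fin (N - 1)) (Fin (N - 1)) ℝ :=
  Matrix.of fun i j => (N : ℝ) ^ 2 *
    (if i = j then 2 else if (i : ℕ) + 1 = j ∨ (j : ℕ) + 1 = i then -1 else 0)

/-- The projection `P_N v = ∑_{k=1}^{N-1} (v, φ_k) φ_k`, orthogonal in `L²(0,1)`. -/
def spectralProj (N : ℕ) (v : ℝ → ℝ) (x : ℝ) : ℝ :=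
  ∑ k ∈ Finset.Icc 1 (N - 1), pairing v (eigfun k) * eigfun k x

/-- `U : [0,T] → ℝ^{N-1}` is a solution of the modified central difference scheme
`∂_t^α (U_i - (P_N u₀)(x_i)) + N² ∑_j w_{i,j} U_j = (P_N f)(x_i)` with `U_i(0) = (P_N u₀)(x_i)`. -/
structure IsModifiedSchemeSolution (α T : ℝ) (N : ℕ) (u₀ : ℝ → ℝ) (f : ℝ → ℝ → ℝ)
    (U : ℝ → Fin (N - 1) → ℝ) : Prop where
  continuous_time : ContinuousOn U (Icc 0 T)
  initial : U 0 = nodal N (spectralProj N u₀)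
  equation : ∀ t ∈ Ioc 0 T, ∀ i,
    HasRLDeriv α T (fun s => U s i - nodal N (spectralProj N u₀) i)
      (nodal N (spectralProj N (f t)) i - (diffMatrix N).mulVec (U t) i) t

/-- The discrete `l²` norm `((1/M) ∑ v_k²)^{1/2}`. -/
def l2Norm {M : ℕ} (v : Fin M → ℝ) : ℝ := Real.sqrt (1 / (M : ℝ) * ∑ k, v k ^ 2)

/-- The discrete `l^∞` norm `max_k |v_k|`. -/
def lInfNorm {M : ℕ} (v : Fin M → ℝ) : ℝ := ⨆ k, |v k|

/-- `ℓ_h = |ln h|^{1/2}`. -/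
def ell (h : ℝ) : ℝ := |Real.log h| ^ (1 / 2 : ℝ)

/-- The characteristic function of the point `0`. -/
def chi0 (x : ℝ) : ℝ := if x = 0 then 1 else 0

end FracDiff

end

open FracDiff

namespace FracDiff

/-! Both problems are diagonalised by sines. The `k`-th sine coefficient of `u(t)` is `(u₀, φ_k)
E_α(-λ_k t^α)`; the coefficient of the scheme, for `k < N`, is the same with `λ_k` replaced by the
matrix eigenvalue `λ_k^h = 4N² sin²(kπ/2N)`. The error at the nodes therefore splits into low modes
`k < N` and high modes `k ≥ N`.

The low modes rest on `0 ≤ λ_k - λ_k^h ≤ λ_k²/(12N²)`, `λ_k ≤ 3λ_k^h` and `E_α(-x) - E_α(-y) ≤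
C(y-x)/x²`: the powers of `λ_k` cancel, and each multiplier is off by `O(h² t^{-α})` uniformly in
`k` (`abs_ml_sub_ml_discEig_le`). Discrete orthogonality turns this into the `l²` bound, without any
smoothness of `u₀`. In the maximum norm, Cauchy-Schwarz costs the factor `(∑_{k<N} k^{-2σ})^{1/2}`,
the source of the exponent `σ + 3/2` and of the logarithm at `σ = 1/2`.

The high modes decay like `E_α(-x) ≤ C/x`. At the nodes the mode `mN + r` is `±` the mode `r`, so
each block of `N` frequencies is again orthogonal (`norm_block`), and the blocks are summed with
weights `1/m²` (`norm_tail_le`).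

The bounds on `E_α` and uniqueness for the scalar equation come from a comparison principle: at a
negative minimum of `v` the Riemann-Liouville derivative is negative (`nonneg_of_rlDeriv_ge`). No
contour integrals or complete monotonicity are needed. -/

theorem hasSum_congr {f g : ℕ → ℝ} {a : ℝ} (h : ∀ n, f n = g n) : HasSum f a ↔ HasSum g a := by
  rw [funext h]

/-! ### The Mittag-Leffler series -/

/-- Keep only `t > M` in the Gamma integral and bound `t^(x-1)` below by `M^(x-1)`. Since `M` is
free, Gamma outgrows every geometric sequence. -/
theorem rpow_mul_exp_neg_le_Gamma {M x : ℝ} (hM : 0 ≤ M) (hx : 1 ≤ x) :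
    M ^ (x - 1) * Real.exp (-M) ≤ Real.Gamma x := by
  have hint := Real.GammaIntegral_convergent (s := x) (by linarith)
  rw [Real.Gamma_eq_integral (by linarith), ← integral_exp_neg_Ioi M, ← integral_const_mul]
  have hsub : Ioi M ⊆ Ioi (0 : ℝ) := Ioi_subset_Ioi hM
  calc ∫ t in Ioi M, M ^ (x - 1) * Real.exp (-t)
      ≤ ∫ t in Ioi M, Real.exp (-t) * t ^ (x - 1) := by
        refine setIntegral_mono_on₀ ?_ (hint.mono_set hsub) measurableSet_Ioi.nullMeasurableSet ?_
        · exact (integrableOn_exp_neg_Ioi M).const_mul _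
        · intro t ht
          rw [mul_comm]
          exact mul_le_mul_of_nonneg_left
            (Real.rpow_le_rpow hM (le_of_lt ht) (by linarith)) (Real.exp_pos _).le
    _ ≤ _ := by
        refine setIntegral_mono_set hint ?_ (Eventually.of_forall hsub)
        filter_upwards [self_mem_ae_restrict measurableSet_Ioi] with t ht
        exact mul_nonneg (Real.exp_pos _).le (Real.rpow_nonneg (le_of_lt ht) _)

theorem summable_pow_div_Gamma {α : ℝ} (hα : 0 < α) {c : ℝ} (hc : 1 ≤ c) {r : ℝ} (hr : 0 ≤ r) :
    Summable fun n : ℕ => r ^ n / Real.Gamma (c + n * α) := by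
  -- With this `M`, `M^α ≥ 2r` and `M ≥ 1`, so the Gamma bound leaves the geometric majorant `e^M
  -- 2^{-n}`.
  set M : ℝ := (2 * r + 1) ^ (1 / α) with hM
  have h1 : 1 ≤ M := Real.one_le_rpow (by linarith) (by positivity)
  have hMα : M ^ α = 2 * r + 1 := by
    rw [hM, ← Real.rpow_mul (by linarith), one_div, inv_mul_cancel₀ hα.ne', Real.rpow_one]
  refine Summable.of_nonneg_of_le (f := fun n : ℕ => Real.exp M * (1 / 2 : ℝ) ^ n) (fun n => ?_)
    (fun n => ?_) ?_
  · exact div_nonneg (pow_nonneg hr n) (Real.Gamma_pos_of_pos (by positivity)).le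
  · have h2 := rpow_mul_exp_neg_le_Gamma (M := M) (x := c + n * α) (by linarith)
      (by nlinarith [mul_nonneg (Nat.cast_nonneg (α := ℝ) n) hα.le])
    have h3 : (2 * r) ^ n ≤ M ^ (c + n * α - 1) := by
      calc (2 * r) ^ n ≤ (M ^ α) ^ n := by
            apply pow_le_pow_left₀ (by linarith); rw [hMα]; linarith
        _ = M ^ (n * α) := by
            rw [← Real.rpow_natCast, ← Real.rpow_mul (by linarith), mul_comm]
        _ ≤ _ := Real.rpow_le_rpow_of_exponent_le h1 (by linarith)
    rw [div_le_iff₀ (Real.Gamma_pos_of_pos (by positivity))]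
    calc r ^ n = Real.exp M * (1 / 2) ^ n * ((2 * r) ^ n * Real.exp (-M)) := by
          rw [mul_pow, Real.exp_neg]
          have : (1 / 2 : ℝ) ^ n * 2 ^ n = 1 := by rw [← mul_pow]; norm_num
          field_simp
          linear_combination -(r ^ n) * this
      _ ≤ _ := by
          refine mul_le_mul_of_nonneg_left (le_trans ?_ h2) (by positivity)
          exact mul_le_mul_of_nonneg_right h3 (Real.exp_pos _).le
  · exact (summable_geometric_of_lt_one (by norm_num) (by norm_num)).mul_left _

/-- The Mittag-Leffler function `x ↦ E_α(-x) = ∑ (-x)ⁿ / Γ(1 + nα)`. -/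
noncomputable def ml (α x : ℝ) : ℝ := ∑' n : ℕ, (-x) ^ n / Real.Gamma (1 + n * α)

theorem hasSum_ml {α : ℝ} (hα : 0 < α) (x : ℝ) :
    HasSum (fun n : ℕ => (-x) ^ n / Real.Gamma (1 + n * α)) (ml α x) := by
  refine (Summable.of_norm ?_).hasSum
  refine (summable_pow_div_Gamma hα le_rfl (abs_nonneg x)).congr fun n => ?_
  rw [norm_div, norm_pow, norm_neg, Real.norm_eq_abs, Real.norm_eq_abs,
    abs_of_pos (Real.Gamma_pos_of_pos (by positivity))]

theorem ml_zero {α : ℝ} : ml α 0 = 1 := by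
  unfold ml
  rw [tsum_eq_single 0]
  · simp
  · intro n hn
    simp [hn]

theorem differentiable_ml {α : ℝ} (hα : 0 < α) : Differentiable ℝ (ml α) := by
  set c : ℕ → ℝ := fun n => 1 / Real.Gamma (1 + n * α)
  have hrad : (FormalMultilinearSeries.ofScalars ℝ c).radius = ⊤ := by
    refine FormalMultilinearSeries.radius_eq_top_of_summable_norm _ fun r => ?_
    refine (summable_pow_div_Gamma hα le_rfl r.coe_nonneg).congr fun n => ?_
    rw [FormalMultilinearSeries.ofScalars_norm, Real.norm_eq_abs,
      abs_of_pos (one_div_pos.2 (Real.Gamma_pos_of_pos (by positivity)))]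
    rw [div_mul_eq_mul_div, one_mul]
  have h := ((FormalMultilinearSeries.ofScalars ℝ c).hasFPowerSeriesOnBall
    (by rw [hrad]; exact ENNReal.zero_lt_top)).differentiableOn
  rw [hrad, Metric.eball_top, differentiableOn_univ] at h
  have h2 : Differentiable ℝ fun x : ℝ => (FormalMultilinearSeries.ofScalars ℝ c).sum (-x) :=
    h.comp differentiable_fun_id.neg
  convert h2 using 1
  funext x
  change ml α x = FormalMultilinearSeries.ofScalarsSum c (-x)
  rw [FormalMultilinearSeries.ofScalars_sum_eq]
  unfold ml
  refine tsum_congr fun n => ?_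
  simp only [c, smul_eq_mul]
  ring

/-! ### Abel integrals of the Mittag-Leffler function -/

theorem intervalIntegrable_sub_rpow {α : ℝ} (hα : α < 1) (t a b : ℝ) :
    IntervalIntegrable (fun ξ => (t - ξ) ^ (-α)) volume a b := by
  have := (intervalIntegral.intervalIntegrable_rpow' (a := t - a) (b := t - b) (r := -α)
    (by linarith)).comp_sub_left t (by simp)
  simpa using this

theorem integral_rpow_mul_sub_rpow {s r t : ℝ} (hs : 0 < s) (hr : 0 < r) (ht : 0 < t) :
    ∫ x in (0 : ℝ)..t, x ^ (s - 1) * (t - x) ^ (r - 1) =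
      t ^ (s + r - 1) * (Real.Gamma s * Real.Gamma r / Real.Gamma (s + r)) := by
  have h := Complex.betaIntegral_scaled s r ht
  rw [Complex.betaIntegral_eq_Gamma_mul_div _ _ (by simpa) (by simpa)] at h
  have e : ∫ x in (0 : ℝ)..t, (x : ℂ) ^ ((s : ℂ) - 1) * ((t : ℂ) - x) ^ ((r : ℂ) - 1) =
      ∫ x in (0 : ℝ)..t, ((x ^ (s - 1) * (t - x) ^ (r - 1) : ℝ) : ℂ) := by
    refine intervalIntegral.integral_congr fun x hx => ?_
    rw [uIcc_of_le ht.le] at hx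
    rw [Complex.ofReal_mul, Complex.ofReal_cpow hx.1, Complex.ofReal_cpow (by linarith [hx.2])]
    push_cast
    rfl
  rw [e, intervalIntegral.integral_ofReal] at h
  have h3 : (t : ℂ) ^ ((s : ℂ) + r - 1) = ((t ^ (s + r - 1) : ℝ) : ℂ) := by
    rw [Complex.ofReal_cpow ht.le]; push_cast; rfl
  rw [h3, ← Complex.ofReal_add, Complex.Gamma_ofReal, Complex.Gamma_ofReal,
    Complex.Gamma_ofReal] at h
  exact_mod_cast h

theorem neg_mul_rpow_pow {lam α s : ℝ} (hs : 0 ≤ s) (n : ℕ) :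
    (-(lam * s ^ α)) ^ n = (-lam) ^ n * s ^ (n * α) := by
  rw [← neg_mul, mul_pow, ← Real.rpow_natCast (s ^ α), ← Real.rpow_mul hs, mul_comm α]

/-- Termwise integration by dominated convergence. The weight `k` is left general to cover both the
Abel kernel and the constant `1`. -/
theorem hasSum_integral_mul_ml {α lam t : ℝ} (hα : 0 < α) (ht : 0 ≤ t) {k : ℝ → ℝ}
    (hk : IntervalIntegrable k volume 0 t) :
    HasSum (fun n : ℕ => (-lam) ^ n / Real.Gamma (1 + n * α) *
        ∫ s in (0 : ℝ)..t, k s * s ^ (n * α))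
      (∫ s in (0 : ℝ)..t, k s * ml α (lam * s ^ α)) := by
  have hpos : ∀ n : ℕ, 0 < Real.Gamma (1 + n * α) := fun n =>
    Real.Gamma_pos_of_pos (by positivity)
  have hcont : ∀ n : ℕ, Continuous fun s : ℝ => s ^ (n * α) := fun n =>
    Real.continuous_rpow_const (by positivity)
  have key := intervalIntegral.hasSum_integral_of_dominated_convergence (a := 0) (b := t)
    (μ := volume) (F := fun (n : ℕ) s => k s * ((-lam) ^ n / Real.Gamma (1 + n * α) * s ^ (n * α)))
    (f := fun s => k s * ml α (lam * s ^ α))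
    (fun n s => ‖k s‖ * ((|lam| * t ^ α) ^ n / Real.Gamma (1 + n * α))) ?_ ?_ ?_ ?_ ?_
  · refine (hasSum_congr fun n => ?_).mp key
    rw [← intervalIntegral.integral_const_mul]
    congr 1
    funext s
    ring
  · intro n
    have h1 : IntervalIntegrable (fun s => k s *
        ((-lam) ^ n / Real.Gamma (1 + n * α) * s ^ (n * α))) volume 0 t :=
      hk.mul_continuousOn (continuous_const.mul (hcont n)).continuousOn
    rw [uIoc_of_le ht]
    exact h1.1.aestronglyMeasurable
  · intro n
    refine Eventually.of_forall fun s hs => ?_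
    rw [uIoc_of_le ht] at hs
    rw [norm_mul, norm_mul, norm_div, norm_pow, norm_neg, Real.norm_of_nonneg (hpos n).le,
      Real.norm_of_nonneg (Real.rpow_nonneg hs.1.le _), mul_pow, ← Real.rpow_natCast (t ^ α),
      ← Real.rpow_mul ht, mul_comm α, div_mul_eq_mul_div]
    have : s ^ (n * α) ≤ t ^ (n * α) := Real.rpow_le_rpow hs.1.le hs.2 (by positivity)
    have := hpos n
    rw [Real.norm_eq_abs lam]
    gcongr
  · exact Eventually.of_forall fun s _ =>
      (summable_pow_div_Gamma hα le_rfl (by positivity)).mul_left _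
  · simp_rw [tsum_mul_left]
    exact hk.norm.mul_const _
  · refine Eventually.of_forall fun s hs => ?_
    rw [uIoc_of_le ht] at hs
    refine (hasSum_congr fun n => ?_).mp (HasSum.mul_left (k s) (hasSum_ml hα (lam * s ^ α)))
    rw [neg_mul_rpow_pow hs.1.le]
    ring

theorem continuous_ml_rpow {α : ℝ} (hα : 0 < α) (lam : ℝ) :
    Continuous fun s : ℝ => ml α (lam * s ^ α) :=
  (differentiable_ml hα).continuous.comp
    (continuous_const.mul (Real.continuous_rpow_const hα.le))

/-- By the Beta integral, term `n + 1` of the Abel integral is `-lam` times term `n` of the plain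
integral; the term `n = 0` gives the power of `t`. -/
theorem rlPrimitive_ml {α : ℝ} (hα : 0 < α) (hα1 : α < 1) (lam : ℝ) {t : ℝ} (ht : 0 < t) :
    rlPrimitive α (fun s => ml α (lam * s ^ α)) t =
      t ^ (1 - α) / Real.Gamma (2 - α) - lam * ∫ s in (0 : ℝ)..t, ml α (lam * s ^ α) := by
  have hG : Real.Gamma (1 - α) ≠ 0 := (Real.Gamma_pos_of_pos (by linarith)).ne'
  have h1 := (hasSum_integral_mul_ml (lam := lam) hα ht.le
    (intervalIntegrable_sub_rpow hα1 t 0 t)).mul_left (1 / Real.Gamma (1 - α))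
  have h2 := (hasSum_integral_mul_ml (lam := lam) hα ht.le
    (k := fun _ => 1) intervalIntegrable_const).mul_left (-lam)
  simp only [one_mul] at h2
  change HasSum _ (rlPrimitive α (fun s => ml α (lam * s ^ α)) t) at h1
  rw [← hasSum_nat_add_iff' 1] at h1
  have h3 := h1.unique ((hasSum_congr fun n => ?_).mp h2)
  · rw [sub_eq_iff_eq_add] at h3
    rw [h3, neg_mul, add_comm, ← sub_eq_add_neg]
    congr 1
    have := integral_rpow_mul_sub_rpow (s := 1) (r := 1 - α) one_pos (by linarith) ht
    simp only [sub_self, Real.rpow_zero, one_mul] at this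
    simp only [Finset.range_one, Finset.sum_singleton, pow_zero, Nat.cast_zero, zero_mul, add_zero,
      Real.Gamma_one, div_one, one_mul, Real.rpow_zero, mul_one]
    rw [show -α = 1 - α - 1 by ring, this, Real.Gamma_one, show 1 + (1 - α) - 1 = 1 - α by ring,
      show 1 + (1 - α) = 2 - α by ring]
    field_simp
  · have e1 := integral_rpow_mul_sub_rpow (s := 1 + (n + 1 : ℕ) * α) (r := 1 - α)
      (by positivity) (by linarith) ht
    have e2 : ∫ s in (0 : ℝ)..t, s ^ (n * α) = t ^ (n * α + 1) / (n * α + 1) := by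
      rw [integral_rpow (Or.inl (by have : 0 ≤ n * α := by positivity
                                    linarith)), Real.zero_rpow (by positivity), sub_zero]
    have e3 : ∫ s in (0 : ℝ)..t, (t - s) ^ (-α) * s ^ ((n + 1 : ℕ) * α) =
        ∫ s in (0 : ℝ)..t, s ^ (1 + (n + 1 : ℕ) * α - 1) * (t - s) ^ (1 - α - 1) := by
      congr 1
      funext s
      rw [mul_comm]
      congr 2 <;> ring
    have e4 : Real.Gamma (1 + (n + 1 : ℕ) * α + (1 - α)) =
        (1 + n * α) * Real.Gamma (1 + n * α) := by
      rw [← Real.Gamma_add_one (by positivity)]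
      congr 1
      push_cast
      ring
    have g1 := (Real.Gamma_pos_of_pos (show 0 < 1 + (n : ℝ) * α by positivity)).ne'
    have g2 := (Real.Gamma_pos_of_pos (show 0 < 1 + ((n + 1 : ℕ) : ℝ) * α by positivity)).ne'
    have g3 : 1 + (n : ℝ) * α ≠ 0 := by positivity
    rw [e3, e1, e2, e4, show 1 + ((n + 1 : ℕ) : ℝ) * α + (1 - α) - 1 = n * α + 1 by push_cast; ring,
      add_comm (n * α : ℝ) 1, pow_succ]
    field_simp

theorem hasDerivAt_rlPrimitive_ml {α : ℝ} (hα : 0 < α) (hα1 : α < 1) (lam : ℝ) {t : ℝ}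
    (ht : 0 < t) :
    HasDerivAt (rlPrimitive α (fun s => ml α (lam * s ^ α)))
      (t ^ (-α) / Real.Gamma (1 - α) - lam * ml α (lam * t ^ α)) t := by
  have hG : Real.Gamma (2 - α) = (1 - α) * Real.Gamma (1 - α) := by
    rw [← Real.Gamma_add_one (by linarith)]
    congr 1
    ring
  have hc := continuous_ml_rpow hα lam
  have h1 : HasDerivAt (fun t : ℝ => t ^ (1 - α) / Real.Gamma (2 - α))
      (t ^ (-α) / Real.Gamma (1 - α)) t := by
    have h := (Real.hasDerivAt_rpow_const (p := 1 - α) (Or.inl ht.ne')).div_const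
      (Real.Gamma (2 - α))
    rwa [hG, show 1 - α - 1 = -α by ring, mul_div_mul_left _ _ (by linarith), ← hG] at h
  have h2 := (intervalIntegral.integral_hasDerivAt_right (hc.intervalIntegrable 0 t)
    (hc.stronglyMeasurableAtFilter _ _) hc.continuousAt).const_mul lam
  refine (h1.sub h2).congr_of_eventuallyEq ?_
  filter_upwards [lt_mem_nhds ht] with s hs
  exact rlPrimitive_ml hα hα1 lam hs

/-! ### Calculus of the Riemann-Liouville derivative and the comparison principle -/

theorem intervalIntegrable_abel {α t : ℝ} (hα1 : α < 1) (ht : 0 ≤ t) {g : ℝ → ℝ}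
    (hg : ContinuousOn g (Icc 0 t)) :
    IntervalIntegrable (fun ξ => (t - ξ) ^ (-α) * g ξ) volume 0 t :=
  (intervalIntegrable_sub_rpow hα1 t 0 t).mul_continuousOn (by rwa [uIcc_of_le ht])

theorem rlPrimitive_linear {α t : ℝ} (hα1 : α < 1) (ht : 0 ≤ t) {f g : ℝ → ℝ}
    (hf : ContinuousOn f (Icc 0 t)) (hg : ContinuousOn g (Icc 0 t)) (a b : ℝ) :
    rlPrimitive α (fun s => a * f s + b * g s) t =
      a * rlPrimitive α f t + b * rlPrimitive α g t := by
  unfold rlPrimitive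
  have h := intervalIntegral.integral_add ((intervalIntegrable_abel hα1 ht hf).const_mul a)
    ((intervalIntegrable_abel hα1 ht hg).const_mul b)
  rw [intervalIntegral.integral_const_mul, intervalIntegral.integral_const_mul] at h
  have e : (fun ξ => (t - ξ) ^ (-α) * (a * f ξ + b * g ξ)) =
      fun ξ => a * ((t - ξ) ^ (-α) * f ξ) + b * ((t - ξ) ^ (-α) * g ξ) := by
    funext ξ
    ring
  rw [e, h]
  ring

theorem rlPrimitive_congr {α t : ℝ} (ht : 0 ≤ t) {f g : ℝ → ℝ} (h : EqOn f g (Icc 0 t)) :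
    rlPrimitive α f t = rlPrimitive α g t := by
  unfold rlPrimitive
  congr 1
  refine intervalIntegral.integral_congr fun ξ hξ => ?_
  rw [uIcc_of_le ht] at hξ
  simp only [h hξ]

theorem HasRLDeriv.congr {α T t d : ℝ} {f g : ℝ → ℝ} (hf : HasRLDeriv α T f d t)
    (h : EqOn g f (Icc 0 T)) (ht : t ∈ Icc 0 T) : HasRLDeriv α T g d t :=
  HasDerivWithinAt.congr_of_mem hf
    (fun _ hs => rlPrimitive_congr hs.1 (h.mono (Icc_subset_Icc_right hs.2))) ht

theorem HasRLDeriv.linear {α T t d e : ℝ} (hα1 : α < 1) {f g : ℝ → ℝ}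
    (hf : HasRLDeriv α T f d t) (hg : HasRLDeriv α T g e t)
    (hfc : ContinuousOn f (Icc 0 T)) (hgc : ContinuousOn g (Icc 0 T)) (ht : t ∈ Icc 0 T)
    (a b : ℝ) : HasRLDeriv α T (fun s => a * f s + b * g s) (a * d + b * e) t :=
  HasDerivWithinAt.congr_of_mem ((HasDerivWithinAt.const_mul a hf).add
    (HasDerivWithinAt.const_mul b hg))
    (fun _ hs => rlPrimitive_linear hα1 hs.1 (hfc.mono (Icc_subset_Icc_right hs.2))
      (hgc.mono (Icc_subset_Icc_right hs.2)) a b) ht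

theorem integral_sub_rpow {α t : ℝ} (hα1 : α < 1) :
    ∫ ξ in (0 : ℝ)..t, (t - ξ) ^ (-α) = t ^ (1 - α) / (1 - α) := by
  rw [intervalIntegral.integral_comp_sub_left (fun x => x ^ (-α)), sub_self, sub_zero,
    integral_rpow (Or.inl (by linarith)), Real.zero_rpow (by linarith), sub_zero,
    show -α + 1 = 1 - α by ring]

/-- Difference quotients of the Abel integral at a zero of a nonnegative function. -/
theorem abel_integral_sub_le {α s t L : ℝ} (hα : 0 < α) (hα1 : α < 1) (hs : 0 ≤ s) (hst : s < t)
    {p : ℝ → ℝ} (hL : 0 ≤ L) (hp : ContinuousOn p (Icc 0 t)) (hp0 : ∀ ξ ∈ Icc 0 t, 0 ≤ p ξ)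
    (hpL : ∀ ξ ∈ Icc s t, p ξ ≤ L * (t - ξ)) :
    (∫ ξ in (0 : ℝ)..t, (t - ξ) ^ (-α) * p ξ) - ∫ ξ in (0 : ℝ)..s, (s - ξ) ^ (-α) * p ξ ≤
      L * (t - s) ^ (1 - α) * (t - s) := by
  have hi := intervalIntegrable_abel hα1 (hs.trans hst.le) hp
  have hi1 : IntervalIntegrable (fun ξ => (t - ξ) ^ (-α) * p ξ) volume 0 s :=
    hi.mono_set (by rw [uIcc_of_le hs, uIcc_of_le (hs.trans hst.le)]
                    exact Icc_subset_Icc_right hst.le)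
  have hi2 : IntervalIntegrable (fun ξ => (t - ξ) ^ (-α) * p ξ) volume s t :=
    hi.mono_set (by rw [uIcc_of_le hst.le, uIcc_of_le (hs.trans hst.le)]
                    exact Icc_subset_Icc_left hs)
  rw [← intervalIntegral.integral_add_adjacent_intervals hi1 hi2]
  -- Raising the endpoint from `s` to `t` lowers the kernel on `[0, s]`, and `p ≥ 0`; only the short
  -- interval `[s, t]` can increase the integral.
  have h1 : ∫ ξ in (0 : ℝ)..s, (t - ξ) ^ (-α) * p ξ ≤ ∫ ξ in (0 : ℝ)..s, (s - ξ) ^ (-α) * p ξ := by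
    refine intervalIntegral.integral_mono_on_of_le_Ioo hs hi1
      (intervalIntegrable_abel hα1 hs (hp.mono (Icc_subset_Icc_right hst.le))) fun ξ hξ => ?_
    refine mul_le_mul_of_nonneg_right ?_ (hp0 ξ ⟨hξ.1.le, (hξ.2.trans hst).le⟩)
    exact Real.rpow_le_rpow_of_nonpos (by linarith [hξ.2]) (by linarith) (by linarith)
  have h2 : ∫ ξ in s..t, (t - ξ) ^ (-α) * p ξ ≤ ∫ _ in s..t, L * (t - s) ^ (1 - α) := by
    refine intervalIntegral.integral_mono_on_of_le_Ioo hst.le hi2 intervalIntegrable_const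
      fun ξ hξ => ?_
    have hpos : 0 < t - ξ := by linarith [hξ.2]
    calc (t - ξ) ^ (-α) * p ξ ≤ (t - ξ) ^ (-α) * (L * (t - ξ)) :=
          mul_le_mul_of_nonneg_left (hpL ξ ⟨hξ.1.le, hξ.2.le⟩) (Real.rpow_nonneg hpos.le _)
      _ = L * (t - ξ) ^ (1 - α) := by
          rw [show 1 - α = -α + 1 by ring, Real.rpow_add_one hpos.ne']
          ring
      _ ≤ _ := by
          refine mul_le_mul_of_nonneg_left ?_ hL
          exact Real.rpow_le_rpow hpos.le (by linarith [hξ.1]) (by linarith)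
  rw [intervalIntegral.integral_const, smul_eq_mul, mul_comm (t - s)] at h2
  linarith

theorem rlPrimitive_eq_sub_const {α t : ℝ} (hα1 : α < 1) (ht : 0 ≤ t) {v : ℝ → ℝ}
    (hv : ContinuousOn v (Icc 0 t)) (m : ℝ) :
    rlPrimitive α v t = 1 / Real.Gamma (1 - α) *
      ((∫ ξ in (0 : ℝ)..t, (t - ξ) ^ (-α) * (v ξ - m)) + m * (t ^ (1 - α) / (1 - α))) := by
  have hi : IntervalIntegrable (fun ξ => (t - ξ) ^ (-α) * (v ξ - m)) volume 0 t :=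
    intervalIntegrable_abel hα1 ht (hv.sub continuousOn_const)
  unfold rlPrimitive
  rw [← integral_sub_rpow hα1, ← intervalIntegral.integral_const_mul m,
    ← intervalIntegral.integral_add hi ((intervalIntegrable_sub_rpow hα1 t 0 t).const_mul m)]
  congr 2
  funext ξ
  ring

/-- Comparison principle for the Riemann-Liouville derivative. -/
theorem nonneg_of_rlDeriv_ge {α T lam : ℝ} (hα : 0 < α) (hα1 : α < 1) (hlam : 0 ≤ lam)
    {v : ℝ → ℝ} (hc : ContinuousOn v (Icc 0 T)) (h0 : 0 ≤ v 0)
    (hd : ∀ t ∈ Ioc 0 T, DifferentiableAt ℝ v t)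
    (hD : ∀ t ∈ Ioc 0 T, ∃ d, HasRLDeriv α T v d t ∧ -lam * v t ≤ d) :
    ∀ t ∈ Icc 0 T, 0 ≤ v t := by
  intro t1 ht1
  by_contra! hneg
  -- A negative value forces a negative minimum `m`, attained at some `t > 0` since `v 0 ≥ 0`. As `t
  -- = T` is possible, only left difference quotients are used.
  obtain ⟨t, ht, hmin⟩ := isCompact_Icc.exists_isMinOn ⟨t1, ht1⟩ hc
  have hmin' : ∀ s ∈ Icc 0 T, v t ≤ v s := fun s hs => hmin hs
  have hm : v t < 0 := (hmin' t1 ht1).trans_lt hneg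
  have ht0 : 0 < t := by
    rcases ht.1.lt_or_eq with h | h
    · exact h
    · rw [← h] at hm
      linarith
  obtain ⟨d, hder, hdle⟩ := hD t ⟨ht0, ht.2⟩
  set m := v t with hmdef
  set q : ℝ → ℝ := fun s => s ^ (1 - α) / (1 - α)
  have hG : 0 < 1 / Real.Gamma (1 - α) :=
    one_div_pos.2 (Real.Gamma_pos_of_pos (by linarith))
  have hq : HasDerivAt q (t ^ (-α)) t := by
    have h := (Real.hasDerivAt_rpow_const (p := 1 - α) (Or.inl ht0.ne')).div_const (1 - α)
    rwa [show 1 - α - 1 = -α by ring, mul_div_cancel_left₀ _ (by linarith : 1 - α ≠ 0)] at h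
  have hqs : Tendsto (slope q t) (𝓝[<] t) (𝓝 (t ^ (-α))) :=
    (hasDerivWithinAt_iff_tendsto_slope' (s := Iio t) self_notMem_Iio).1 hq.hasDerivWithinAt
  have hfs : Tendsto (slope (rlPrimitive α v) t) (𝓝[<] t) (𝓝 d) := by
    refine (hasDerivWithinAt_iff_tendsto_slope' (s := Iio t) self_notMem_Iio).1
      (HasDerivWithinAt.mono_of_mem_nhdsWithin hder ?_)
    filter_upwards [Ioo_mem_nhdsLT ht0] with s hs using ⟨hs.1.le, hs.2.le.trans ht.2⟩
  obtain ⟨L, hL, hbig⟩ := ((hd t ⟨ht0, ht.2⟩).hasDerivAt.isBigO_sub).exists_nonneg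
  rw [Asymptotics.isBigOWith_iff] at hbig
  obtain ⟨δ, hδ, hball⟩ := Metric.eventually_nhds_iff.1 hbig
  have hrpow : Tendsto (fun s : ℝ => L * (t - s) ^ (1 - α)) (𝓝[<] t) (𝓝 0) := by
    have : Tendsto (fun s : ℝ => L * (t - s) ^ (1 - α)) (𝓝 t) (𝓝 (L * (t - t) ^ (1 - α))) := by
      refine Continuous.tendsto ?_ t
      exact continuous_const.mul ((Real.continuous_rpow_const (by linarith)).comp
        (continuous_const.sub continuous_id))
    rw [sub_self, Real.zero_rpow (by linarith), mul_zero] at this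
    exact this.mono_left nhdsWithin_le_nhds
  -- Split `v = (v - m) + m`. The left quotients of the Abel integral of `v - m` are at most `L
  -- (t-s)^(1-α) → 0`, and the constant contributes `m t^(-α)`.
  have hle : d ≤ 1 / Real.Gamma (1 - α) * (0 + m * t ^ (-α)) := by
    refine le_of_tendsto_of_tendsto hfs ((hrpow.add (hqs.const_mul m)).const_mul _) ?_
    filter_upwards [Ioo_mem_nhdsLT (max_lt ht0 (sub_lt_self t hδ))] with s hs
    have hs0 : 0 < s := (le_max_left _ _).trans_lt hs.1
    have hsδ : t - δ < s := (le_max_right _ _).trans_lt hs.1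
    have key := abel_integral_sub_le (p := fun ξ => v ξ - m) hα hα1 hs0.le hs.2 hL
      ((hc.mono (Icc_subset_Icc_right ht.2)).sub continuousOn_const)
      (fun ξ hξ => sub_nonneg.2 (hmin' ξ ⟨hξ.1, hξ.2.trans ht.2⟩)) (fun ξ hξ => by
        have h1 := hball (y := ξ) (by
          rw [Real.dist_eq, abs_sub_comm, abs_of_nonneg (by linarith [hξ.2])]
          linarith [hξ.1])
        rw [Real.norm_eq_abs, Real.norm_eq_abs, abs_sub_comm ξ, abs_of_nonneg
          (by linarith [hξ.2] : 0 ≤ t - ξ)] at h1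
        exact (le_abs_self _).trans h1)
    rw [slope_def_field, slope_def_field, ← neg_div_neg_eq, div_le_iff₀ (by linarith [hs.2]),
      rlPrimitive_eq_sub_const hα1 ht0.le (hc.mono (Icc_subset_Icc_right ht.2)) m,
      rlPrimitive_eq_sub_const hα1 hs0.le (hc.mono (Icc_subset_Icc_right (hs.2.le.trans ht.2))) m]
    have e : 1 / Real.Gamma (1 - α) * (L * (t - s) ^ (1 - α) + m * ((q s - q t) / (s - t))) *
        -(s - t) = 1 / Real.Gamma (1 - α) * (L * (t - s) ^ (1 - α) * (t - s) + m * (q t - q s)) := by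
      have : s - t ≠ 0 := by linarith [hs.2]
      have h2 : (q s - q t) / (s - t) * (s - t) = q s - q t := div_mul_cancel₀ _ this
      linear_combination (-(1 / Real.Gamma (1 - α)) * m) * h2
    rw [e]
    simp only [q]
    have := mul_le_mul_of_nonneg_left key hG.le
    linarith
  -- Thus `d < 0`, whereas `-lam * m ≥ 0`.
  have : 1 / Real.Gamma (1 - α) * (0 + m * t ^ (-α)) < 0 := by
    rw [zero_add]
    exact mul_neg_of_pos_of_neg hG (mul_neg_of_neg_of_pos hm (Real.rpow_pos_of_pos ht0 _))
  nlinarith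

/-! ### Bounds for the Mittag-Leffler function -/

theorem hasRLDeriv_ml {α T t : ℝ} (hα : 0 < α) (hα1 : α < 1) (lam : ℝ) (ht : t ∈ Ioc 0 T) :
    HasRLDeriv α T (fun s => ml α (lam * s ^ α))
      (t ^ (-α) / Real.Gamma (1 - α) - lam * ml α (lam * t ^ α)) t :=
  (hasDerivAt_rlPrimitive_ml hα hα1 lam ht.1).hasDerivWithinAt

theorem differentiableAt_ml_rpow {α t : ℝ} (hα : 0 < α) (lam : ℝ) (ht : 0 < t) :
    DifferentiableAt ℝ (fun s => ml α (lam * s ^ α)) t :=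
  (differentiable_ml hα _).comp t
    ((Real.differentiableAt_rpow_const_of_ne α ht.ne').const_mul lam)

/-- In the equation for `E_α(-x t^α)` the source `t^(-α)/Γ(1-α)` is nonnegative, so the comparison
principle applies; take `t = 1`. -/
theorem ml_nonneg {α x : ℝ} (hα : 0 < α) (hα1 : α < 1) (hx : 0 ≤ x) : 0 ≤ ml α x := by
  have h := nonneg_of_rlDeriv_ge (T := 1) hα hα1 hx (v := fun s => ml α (x * s ^ α))
    (continuous_ml_rpow hα x).continuousOn
    (by simp [Real.zero_rpow hα.ne', ml_zero])
    (fun t ht => differentiableAt_ml_rpow hα x ht.1)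
    (fun t ht => ⟨_, hasRLDeriv_ml hα hα1 x ht, by
      have : 0 ≤ t ^ (-α) / Real.Gamma (1 - α) :=
        div_nonneg (Real.rpow_nonneg ht.1.le _) (Real.Gamma_pos_of_pos (by linarith)).le
      linarith⟩) 1 ⟨zero_le_one, le_rfl⟩
  simpa using h

/-- In the difference the singular sources cancel, and `D v + x v = (y - x) E_α(-y t^α) ≥ 0`. -/
theorem ml_antitone {α x y : ℝ} (hα : 0 < α) (hα1 : α < 1) (hx : 0 ≤ x) (hxy : x ≤ y) :
    ml α y ≤ ml α x := by
  have hcx := continuous_ml_rpow hα x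
  have hcy := continuous_ml_rpow hα y
  have h := nonneg_of_rlDeriv_ge (T := 1) hα hα1 hx
    (v := fun s => 1 * ml α (x * s ^ α) + (-1) * ml α (y * s ^ α))
    (by fun_prop)
    (by simp [Real.zero_rpow hα.ne', ml_zero])
    (fun t ht => ((differentiableAt_ml_rpow hα x ht.1).const_mul 1).add
      ((differentiableAt_ml_rpow hα y ht.1).const_mul (-1)))
    (fun t ht => ⟨_, (hasRLDeriv_ml hα hα1 x ht).linear hα1 (hasRLDeriv_ml hα hα1 y ht)
      hcx.continuousOn hcy.continuousOn (Ioc_subset_Icc_self ht) 1 (-1), by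
      have : 0 ≤ (y - x) * ml α (y * t ^ α) := mul_nonneg (by linarith)
        (ml_nonneg hα hα1 (mul_nonneg (hx.trans hxy) (Real.rpow_nonneg ht.1.le _)))
      linarith⟩) 1 ⟨zero_le_one, le_rfl⟩
  simp only [Real.one_rpow, mul_one] at h
  linarith

/-- At `t = 1` the Abel integral is nonnegative, so `x ∫₀¹ E_α(-x s^α) ds ≤ 1/Γ(2-α)`, and by
monotonicity the integral is at least `E_α(-x)`. -/
theorem ml_le_div {α x : ℝ} (hα : 0 < α) (hα1 : α < 1) (hx : 0 < x) :
    ml α x ≤ 1 / Real.Gamma (2 - α) / x := by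
  have h := rlPrimitive_ml hα hα1 x one_pos
  have h1 : 0 ≤ rlPrimitive α (fun s => ml α (x * s ^ α)) 1 := by
    refine mul_nonneg (one_div_pos.2 (Real.Gamma_pos_of_pos (by linarith))).le ?_
    refine intervalIntegral.integral_nonneg zero_le_one fun s hs => ?_
    exact mul_nonneg (Real.rpow_nonneg (by linarith [hs.2]) _)
      (ml_nonneg hα hα1 (mul_nonneg hx.le (Real.rpow_nonneg hs.1 _)))
  have h2 : ∫ _ in (0 : ℝ)..1, ml α x ≤ ∫ s in (0 : ℝ)..1, ml α (x * s ^ α) := by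
    refine intervalIntegral.integral_mono_on zero_le_one intervalIntegrable_const
      ((continuous_ml_rpow hα x).intervalIntegrable _ _) fun s hs => ?_
    exact ml_antitone hα hα1 (mul_nonneg hx.le (Real.rpow_nonneg hs.1 _))
      (mul_le_of_le_one_right hx.le (Real.rpow_le_one hs.1 hs.2 hα.le))
  rw [intervalIntegral.integral_const, sub_zero, one_smul] at h2
  rw [h, Real.one_rpow] at h1
  rw [le_div_iff₀ hx]
  nlinarith

/-- A substitute for a derivative bound: comparison shows that the average decrease on `[x, y]` is
at most that on `[x/2, x]`, which is at most `E_α(-x/2)/(x/2) ≤ (1/Γ(2-α))/(x/2)²`. -/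
theorem ml_sub_le {α x y : ℝ} (hα : 0 < α) (hα1 : α < 1) (hx : 0 < x) (hxy : x ≤ y) :
    ml α x - ml α y ≤ 4 / Real.Gamma (2 - α) * (y - x) / x ^ 2 := by
  have hcx := continuous_ml_rpow hα x
  have hcy := continuous_ml_rpow hα y
  have hcz := continuous_ml_rpow hα (x / 2)
  have h := nonneg_of_rlDeriv_ge (T := 1) hα hα1 hx.le
    (v := fun s => (y - x) * (1 * ml α (x / 2 * s ^ α) + (-1) * ml α (x * s ^ α)) +
      (-(x / 2)) * (1 * ml α (x * s ^ α) + (-1) * ml α (y * s ^ α)))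
    (by fun_prop)
    (by simp [Real.zero_rpow hα.ne', ml_zero])
    (fun t ht => by
      have d1 := differentiableAt_ml_rpow hα x ht.1
      have d2 := differentiableAt_ml_rpow hα y ht.1
      have d3 := differentiableAt_ml_rpow hα (x / 2) ht.1
      fun_prop)
    (fun t ht => by
      have ht' := Ioc_subset_Icc_self ht
      have r1 := (hasRLDeriv_ml hα hα1 (x / 2) ht).linear hα1 (hasRLDeriv_ml hα hα1 x ht)
        hcz.continuousOn hcx.continuousOn ht' 1 (-1)
      have r2 := (hasRLDeriv_ml hα hα1 x ht).linear hα1 (hasRLDeriv_ml hα hα1 y ht)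
        hcx.continuousOn hcy.continuousOn ht' 1 (-1)
      refine ⟨_, r1.linear hα1 r2 (by fun_prop) (by fun_prop) ht' (y - x) (-(x / 2)), ?_⟩
      have htα : 0 ≤ t ^ α := Real.rpow_nonneg ht.1.le _
      -- This is exactly `D v + x v` for the combination `v` chosen above.
      have : 0 ≤ (y - x) * (x / 2) * (ml α (x / 2 * t ^ α) - ml α (y * t ^ α)) := by
        refine mul_nonneg (mul_nonneg (by linarith) (by linarith)) (sub_nonneg.2 ?_)
        exact ml_antitone hα hα1 (mul_nonneg (by linarith) htα)
          (mul_le_mul_of_nonneg_right (by linarith) htα)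
      linarith) 1 ⟨zero_le_one, le_rfl⟩
  simp only [Real.one_rpow, mul_one] at h
  have h1 := mul_le_mul_of_nonneg_left (ml_le_div hα hα1 (x := x / 2) (by linarith))
    (by linarith : 0 ≤ y - x)
  have h2 : 0 ≤ (y - x) * ml α x := mul_nonneg (by linarith) (ml_nonneg hα hα1 hx.le)
  have h3 : (x / 2) * (ml α x - ml α y) ≤ (y - x) * (1 / Real.Gamma (2 - α) / (x / 2)) := by
    linarith
  have hG := Real.Gamma_pos_of_pos (show 0 < 2 - α by linarith)
  have e : 4 / Real.Gamma (2 - α) * (y - x) / x ^ 2 =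
      (y - x) * (1 / Real.Gamma (2 - α) / (x / 2)) / (x / 2) := by
    field_simp
    ring
  rw [e, le_div_iff₀ (by linarith)]
  linarith

/-! ### Uniqueness for the scalar equation -/

/-- Differentiation commutes with the Abel integral for functions vanishing on `(-∞, 0]`. -/
theorem hasDerivAt_rlPrimitive_of_deriv {α t : ℝ} (hα1 : α < 1) {W w : ℝ → ℝ}
    (hW : ∀ x, HasDerivAt W (w x) x) (hw : Continuous w) {B : ℝ} (hB : ∀ x, |w x| ≤ B)
    (hW0 : ∀ x ≤ 0, W x = 0) (hw0 : ∀ x ≤ 0, w x = 0) :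
    HasDerivAt (rlPrimitive α W) (rlPrimitive α w t) t := by
  have hWc : Continuous W := continuous_iff_continuousAt.2 fun x => (hW x).continuousAt
  -- Reflecting `ξ ↦ s - ξ` moves `s` off the singular kernel. Since `g` vanishes on negative
  -- arguments, the upper limit can be frozen at `t + 1`, leaving a parameter integral.
  have hrep : ∀ g : ℝ → ℝ, Continuous g → (∀ x ≤ 0, g x = 0) → ∀ s, s ≤ t + 1 →
      rlPrimitive α g s =
        1 / Real.Gamma (1 - α) * ∫ ξ in (0 : ℝ)..(t + 1), ξ ^ (-α) * g (s - ξ) := by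
    intro g hg hg0 s hs
    have hi : ∀ a b, IntervalIntegrable (fun ξ : ℝ => ξ ^ (-α) * g (s - ξ)) volume a b :=
      fun a b => (intervalIntegral.intervalIntegrable_rpow' (by linarith)).mul_continuousOn
        (by fun_prop)
    have e0 : ∫ ξ in s..(t + 1), ξ ^ (-α) * g (s - ξ) = 0 := by
      rw [intervalIntegral.integral_congr (g := fun _ => 0), intervalIntegral.integral_zero]
      intro ξ hξ
      rw [uIcc_of_le hs] at hξ
      simp only [hg0 (s - ξ) (by linarith [hξ.1]), mul_zero]
    rw [← intervalIntegral.integral_add_adjacent_intervals (hi 0 s) (hi s (t + 1)), e0, add_zero]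
    unfold rlPrimitive
    congr 1
    have := intervalIntegral.integral_comp_sub_left (a := 0) (b := s)
      (fun ξ => ξ ^ (-α) * g (s - ξ)) s
    simp only [sub_sub_cancel, sub_self, sub_zero] at this
    exact this
  have hker : IntervalIntegrable (fun ξ : ℝ => ξ ^ (-α)) volume 0 (t + 1) :=
    intervalIntegral.intervalIntegrable_rpow' (by linarith)
  have h := intervalIntegral.hasDerivAt_integral_of_dominated_loc_of_deriv_le (μ := volume)
    (a := 0) (b := t + 1) (x₀ := t) (s := univ) (bound := fun ξ => ‖ξ ^ (-α)‖ * B)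
    (F := fun s ξ => ξ ^ (-α) * W (s - ξ)) (F' := fun s ξ => ξ ^ (-α) * w (s - ξ)) univ_mem
    (Eventually.of_forall fun s =>
      ((hker.mul_continuousOn (by fun_prop)).aestronglyMeasurable_restrict_uIoc))
    (hker.mul_continuousOn (by fun_prop))
    ((hker.mul_continuousOn (by fun_prop)).aestronglyMeasurable_restrict_uIoc)
    (Eventually.of_forall fun ξ _ s _ => by
      rw [norm_mul]
      exact mul_le_mul_of_nonneg_left (hB _) (norm_nonneg _))
    (hker.norm.mul_const B)
    (Eventually.of_forall fun ξ _ s _ => ((hW (s - ξ)).comp_sub_const s ξ).const_mul _)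
  rw [hrep w hw hw0 t (by linarith)]
  refine (h.2.const_mul _).congr_of_eventuallyEq ?_
  filter_upwards [gt_mem_nhds (lt_add_one t)] with s hs
  exact hrep W hWc hW0 s hs.le

theorem abs_rlPrimitive_le {α t B : ℝ} (hα1 : α < 1) (ht : 0 ≤ t) {g : ℝ → ℝ}
    (hB : ∀ s ∈ Icc 0 t, |g s| ≤ B) :
    |rlPrimitive α g t| ≤ 1 / Real.Gamma (1 - α) * (B * (t ^ (1 - α) / (1 - α))) := by
  have hG : 0 < 1 / Real.Gamma (1 - α) := one_div_pos.2 (Real.Gamma_pos_of_pos (by linarith))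
  unfold rlPrimitive
  rw [abs_mul, abs_of_pos hG, ← integral_sub_rpow hα1, ← intervalIntegral.integral_const_mul]
  refine mul_le_mul_of_nonneg_left ?_ hG.le
  rw [← Real.norm_eq_abs]
  refine intervalIntegral.norm_integral_le_of_norm_le ht (Eventually.of_forall fun ξ hξ => ?_)
    ((intervalIntegrable_sub_rpow hα1 t 0 t).const_mul B)
  have := Real.rpow_nonneg (by linarith [hξ.2] : 0 ≤ t - ξ) (-α)
  rw [norm_mul, Real.norm_of_nonneg this, mul_comm]
  exact mul_le_mul_of_nonneg_right (hB ξ ⟨hξ.1.le, hξ.2⟩) this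

/-- The comparison principle needs differentiability, which a continuous `w` may lack. Its primitive
`W` is differentiable and satisfies the same equation, so comparison applied to `W` and `-W` gives
`W = 0`. -/
theorem eq_zero_of_hasRLDeriv {α T lam : ℝ} (hα : 0 < α) (hα1 : α < 1) (hlam : 0 ≤ lam)
    (hT : 0 < T) {w : ℝ → ℝ} (hc : ContinuousOn w (Icc 0 T)) (h0 : w 0 = 0)
    (hD : ∀ t ∈ Ioc 0 T, HasRLDeriv α T w (-lam * w t) t) : ∀ t ∈ Icc 0 T, w t = 0 := by
  -- Clamping the argument extends `w` continuously to the line, by zero on the left because `w 0 =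
  -- 0`.
  set g : ℝ → ℝ := fun s => w (max 0 (min T s)) with hg
  have hmem : ∀ s, max 0 (min T s) ∈ Icc 0 T := fun s =>
    ⟨le_max_left _ _, max_le hT.le (min_le_left _ _)⟩
  have hgc : Continuous g := hc.comp_continuous (by fun_prop) hmem
  have hgw : EqOn g w (Icc 0 T) := fun s hs => by
    simp only [hg, min_eq_right hs.2, max_eq_right hs.1]
  have hg0 : ∀ x ≤ 0, g x = 0 := fun x hx => by
    simp only [hg, min_eq_right (hx.trans hT.le), max_eq_left hx, h0]
  obtain ⟨B, hB⟩ := isCompact_Icc.exists_bound_of_continuousOn hc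
  have hgB : ∀ x, |g x| ≤ B := fun x => hB _ (hmem x)
  set W : ℝ → ℝ := fun t => ∫ s in (0 : ℝ)..t, g s with hW
  have hWd : ∀ x, HasDerivAt W (g x) x := fun x => intervalIntegral.integral_hasDerivAt_right
    (hgc.intervalIntegrable 0 x) (hgc.stronglyMeasurableAtFilter _ _) hgc.continuousAt
  have hWc : Continuous W := continuous_iff_continuousAt.2 fun x => (hWd x).continuousAt
  have hW0 : ∀ x ≤ 0, W x = 0 := fun x hx => by
    simp only [hW]
    rw [intervalIntegral.integral_congr (g := fun _ => 0), intervalIntegral.integral_zero]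
    intro s hs
    rw [uIcc_of_ge hx] at hs
    exact hg0 s hs.2
  have hgD : ∀ t ∈ Ioc 0 T, HasRLDeriv α T g (-lam * g t) t := fun t ht => by
    rw [hgw (Ioc_subset_Icc_self ht)]
    exact (hD t ht).congr hgw (Ioc_subset_Icc_self ht)
  have hint : ∀ t ∈ Ioc 0 T, rlPrimitive α g t = -lam * W t := by
    intro t ht
    have hP0 : rlPrimitive α g 0 = 0 := by simp [rlPrimitive]
    have hcont : ContinuousOn (fun s => rlPrimitive α g s + lam * W s) (Icc 0 t) := by
      intro s hs
      refine ContinuousWithinAt.add ?_ (by fun_prop)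
      rcases hs.1.eq_or_lt with h | h
      · rw [← h, ContinuousWithinAt, hP0]
        refine squeeze_zero_norm' (a := fun s => 1 / Real.Gamma (1 - α) *
          (B * (s ^ (1 - α) / (1 - α)))) ?_ ?_
        · filter_upwards [self_mem_nhdsWithin] with x hx
          exact abs_rlPrimitive_le hα1 hx.1 fun y _ => hgB y
        · have : Continuous fun s : ℝ => 1 / Real.Gamma (1 - α) *
              (B * (s ^ (1 - α) / (1 - α))) := by
            have := Real.continuous_rpow_const (q := 1 - α) (by linarith)
            fun_prop
          have h2 := this.tendsto 0
          rw [Real.zero_rpow (by linarith), zero_div, mul_zero, mul_zero] at h2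
          exact h2.mono_left nhdsWithin_le_nhds
      · exact (HasDerivWithinAt.continuousWithinAt (hgD s ⟨h, hs.2.trans ht.2⟩)).mono
          (Icc_subset_Icc_right ht.2)
    -- Mean value theorem: the sum vanishes at `0` and has zero derivative on `(0, t)`.
    obtain ⟨c, -, hc'⟩ := exists_hasDerivAt_eq_slope _ (fun _ => (0 : ℝ)) ht.1 hcont
      (fun s hs => by
        have h1 : HasDerivAt (rlPrimitive α g) (-lam * g s) s :=
          HasDerivWithinAt.hasDerivAt (hgD s ⟨hs.1, hs.2.le.trans ht.2⟩)
            (Icc_mem_nhds hs.1 (hs.2.trans_le ht.2))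
        have h2 := h1.add ((hWd s).const_mul lam)
        rwa [neg_mul, neg_add_cancel] at h2)
    rw [hP0, hW0 0 le_rfl, mul_zero, add_zero, sub_zero, eq_comm, div_eq_zero_iff] at hc'
    rcases hc' with h | h
    · linarith
    · linarith [ht.1]
  have hWD : ∀ t ∈ Ioc 0 T, HasRLDeriv α T W (-lam * W t) t := fun t ht => by
    rw [← hint t ht]
    exact (hasDerivAt_rlPrimitive_of_deriv hα1 hWd hgc hgB hW0 hg0).hasDerivWithinAt
  have hpos := nonneg_of_rlDeriv_ge hα hα1 hlam (T := T) hWc.continuousOn (hW0 0 le_rfl).ge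
    (fun t _ => (hWd t).differentiableAt) (fun t ht => ⟨_, hWD t ht, le_rfl⟩)
  have hneg := nonneg_of_rlDeriv_ge hα hα1 hlam (T := T)
    (v := fun s => (-1) * W s + 0 * W s) (by fun_prop) (by simp [hW0 0 le_rfl])
    (fun t _ => ((hWd t).differentiableAt.const_mul _).add
      ((hWd t).differentiableAt.const_mul _))
    (fun t ht => ⟨_, (hWD t ht).linear hα1 (hWD t ht) hWc.continuousOn hWc.continuousOn
      (Ioc_subset_Icc_self ht) (-1) 0, by linarith⟩)
  have hW00 : ∀ t ∈ Icc 0 T, W t = 0 := fun t ht => by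
    have := hpos t ht
    have := hneg t ht
    linarith
  have hg00 : ∀ t ∈ Ioo 0 T, g t = 0 := fun t ht => by
    refine (hWd t).unique ((hasDerivAt_const t (0 : ℝ)).congr_of_eventuallyEq ?_)
    filter_upwards [Icc_mem_nhds ht.1 ht.2] with s hs using hW00 s hs
  intro t ht
  rw [← hgw ht]
  have hcl : Icc 0 T ⊆ {x | g x = 0} := by
    rw [← closure_Ioo hT.ne]
    exact closure_minimal hg00 (isClosed_eq hgc continuous_const)
  exact hcl ht

/-- The scalar sub-diffusion equation is solved by the Mittag-Leffler function. -/
theorem eq_mul_ml_of_hasRLDeriv {α T lam y₀ : ℝ} (hα : 0 < α) (hα1 : α < 1) (hlam : 0 ≤ lam)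
    (hT : 0 < T) {y : ℝ → ℝ} (hc : ContinuousOn y (Icc 0 T)) (h0 : y 0 = y₀)
    (hD : ∀ t ∈ Ioc 0 T, HasRLDeriv α T (fun s => y s - y₀) (-lam * y t) t) :
    ∀ t ∈ Icc 0 T, y t = y₀ * ml α (lam * t ^ α) := by
  have hml := continuous_ml_rpow hα lam
  have hml0 := continuous_ml_rpow hα 0
  -- Here `w = y - y₀ E_α(-lam s^α)`. The constant `1` is written as `E_α(-0 · s^α)` so that the two
  -- singular sources cancel.
  have key := eq_zero_of_hasRLDeriv hα hα1 hlam hT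
    (w := fun s => 1 * (y s - y₀) + (-y₀) * (1 * ml α (lam * s ^ α) + (-1) * ml α (0 * s ^ α)))
    (by fun_prop) (by simp [h0, Real.zero_rpow hα.ne'])
    (fun t ht => by
      have ht' := Ioc_subset_Icc_self ht
      have h := (hD t ht).linear hα1 ((hasRLDeriv_ml hα hα1 lam ht).linear hα1
        (hasRLDeriv_ml hα hα1 0 ht) hml.continuousOn hml0.continuousOn ht' 1 (-1))
        (by fun_prop) (by fun_prop) ht' 1 (-y₀)
      convert h using 1
      simp only [zero_mul, ml_zero]
      ring)
  intro t ht
  have := key t ht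
  simp only [zero_mul, ml_zero] at this
  linarith

/-! ### Discrete sine modes and the difference matrix -/

theorem two_mul_sin_mul_sum_cos (θ : ℝ) (n : ℕ) :
    2 * Real.sin (θ / 2) * ∑ j ∈ Finset.range n, Real.cos (j * θ) =
      Real.sin (n * θ - θ / 2) + Real.sin (θ / 2) := by
  induction n with
  | zero => simp
  | succ n ih =>
    rw [Finset.sum_range_succ, mul_add, ih]
    have h1 : Real.sin ((n + 1 : ℕ) * θ - θ / 2) =
        Real.sin (n * θ) * Real.cos (θ / 2) + Real.cos (n * θ) * Real.sin (θ / 2) := by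
      rw [← Real.sin_add]
      congr 1
      push_cast
      ring
    rw [h1, Real.sin_sub]
    ring

theorem sum_cos_of_sin_eq_zero {θ : ℝ} {n : ℕ} (h : Real.sin (θ / 2) ≠ 0)
    (hn : Real.sin (n * θ) = 0) :
    ∑ j ∈ Finset.range n, Real.cos (j * θ) = (1 - Real.cos (n * θ)) / 2 := by
  have h1 := two_mul_sin_mul_sum_cos θ n
  rw [Real.sin_sub, hn] at h1
  refine mul_left_cancel₀ (mul_ne_zero two_ne_zero h) ?_
  rw [h1]
  ring

/-- The product is a difference of cosines with angles `jη` and `jθ`. For `a ≠ b` the two sums agree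
because `Nη` and `Nθ` are multiples of `π` of equal parity; for `a = b` one has `η = 0`. -/
theorem sum_two_mul_sin_mul_sin {N a b : ℕ} (ha : 0 < a) (haN : a < N) (hb : 0 < b)
    (hbN : b < N) :
    ∑ j ∈ Finset.range N, 2 * (Real.sin (j * (a * Real.pi / N)) * Real.sin (j * (b * Real.pi / N)))
      = if a = b then (N : ℝ) else 0 := by
  have hN : (0 : ℝ) < N := by exact_mod_cast ha.trans haN
  have ha' : (0 : ℝ) < a := by exact_mod_cast ha
  have hb' : (0 : ℝ) < b := by exact_mod_cast hb
  have haN' : (a : ℝ) < N := by exact_mod_cast haN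
  have hbN' : (b : ℝ) < N := by exact_mod_cast hbN
  have hpi := Real.pi_pos
  set θ := (a + b) * Real.pi / N with hθ
  set η := (a - b) * Real.pi / N with hη
  have e : ∀ j : ℕ, 2 * (Real.sin (j * (a * Real.pi / N)) * Real.sin (j * (b * Real.pi / N))) =
      Real.cos (j * η) - Real.cos (j * θ) := by
    intro j
    have h1 : (j : ℝ) * η = j * (a * Real.pi / N) - j * (b * Real.pi / N) := by rw [hη]; ring
    have h2 : (j : ℝ) * θ = j * (a * Real.pi / N) + j * (b * Real.pi / N) := by rw [hθ]; ring
    rw [h1, h2, Real.cos_sub, Real.cos_add]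
    ring
  have hNθ : (N : ℝ) * θ = a * Real.pi + b * Real.pi := by rw [hθ]; field_simp
  have hNη : (N : ℝ) * η = a * Real.pi - b * Real.pi := by rw [hη]; field_simp
  have hsθ : Real.sin (θ / 2) ≠ 0 := by
    refine (Real.sin_pos_of_pos_of_lt_pi (by positivity) ?_).ne'
    rw [hθ, div_div, div_lt_iff₀ (by positivity)]
    nlinarith
  have hθ0 : Real.sin (N * θ) = 0 := by
    rw [hNθ, Real.sin_add, Real.sin_nat_mul_pi, Real.sin_nat_mul_pi]
    ring
  simp_rw [e]
  rw [Finset.sum_sub_distrib, sum_cos_of_sin_eq_zero hsθ hθ0]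
  split_ifs with hab
  · subst hab
    have : Real.cos (N * θ) = 1 := by
      rw [hNθ, ← two_mul, mul_left_comm, ← Real.cos_nat_mul_two_pi a]
    rw [this, show η = 0 by rw [hη]; simp]
    simp
  · have hsη : Real.sin (η / 2) ≠ 0 := by
      have hne : η ≠ 0 := by
        rw [hη]
        have : (a : ℝ) - b ≠ 0 := sub_ne_zero.2 (by exact_mod_cast hab)
        positivity
      rw [Ne, Real.sin_eq_zero_iff_of_lt_of_lt]
      · exact div_ne_zero hne two_ne_zero
      · rw [hη, div_div, lt_div_iff₀ (by positivity)]
        nlinarith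
      · rw [hη, div_div, div_lt_iff₀ (by positivity)]
        nlinarith
    have hη0 : Real.sin (N * η) = 0 := by
      rw [hNη, Real.sin_sub, Real.sin_nat_mul_pi, Real.sin_nat_mul_pi]
      ring
    rw [sum_cos_of_sin_eq_zero hsη hη0, hNθ, hNη, Real.cos_sub, Real.cos_add,
      Real.sin_nat_mul_pi]
    ring

theorem eigfun_node (N k j : ℕ) :
    eigfun k ((j : ℝ) / N) = Real.sqrt 2 * Real.sin (j * (k * Real.pi / N)) := by
  unfold eigfun
  congr 2
  ring

/-- The values of the modes at the interior nodes. -/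
noncomputable def mode (N : ℕ) (k : ℕ) (i : Fin (N - 1)) : ℝ := eigfun k (((i : ℕ) + 1 : ℝ) / N)

theorem mode_eq (N k : ℕ) (i : Fin (N - 1)) :
    mode N k i = Real.sqrt 2 * Real.sin (((i + 1 : ℕ) : ℝ) * (k * Real.pi / N)) := by
  rw [← eigfun_node, mode, Nat.cast_add, Nat.cast_one]

/-- The matrix of modes is symmetric, so row orthogonality is also column orthogonality; this
inverts the discrete sine transform. -/
theorem mode_symm (N : ℕ) (i k : Fin (N - 1)) : mode N (k + 1) i = mode N (i + 1) k := by
  rw [mode_eq, mode_eq]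
  congr 2
  ring

theorem sum_mode_mul_mode {N : ℕ} (k l : Fin (N - 1)) :
    ∑ i, mode N (k + 1) i * mode N (l + 1) i = if k = l then (N : ℝ) else 0 := by
  have h := sum_two_mul_sin_mul_sin (N := N) (a := k + 1) (b := l + 1) (by omega) (by omega)
    (by omega) (by omega)
  obtain ⟨n, rfl⟩ : ∃ n, N = n + 1 := ⟨N - 1, by have := k.2; omega⟩
  rw [Finset.sum_range_succ'] at h
  simp only [Nat.cast_zero, zero_mul, Real.sin_zero, mul_zero, add_zero, Nat.add_right_cancel_iff,
    ← Fin.ext_iff] at h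
  rw [← h, ← Fin.sum_univ_eq_sum_range (fun j => 2 * (Real.sin (((j + 1 : ℕ) : ℝ) *
    ((k + 1 : ℕ) * Real.pi / (n + 1 : ℕ))) * Real.sin (((j + 1 : ℕ) : ℝ) *
    ((l + 1 : ℕ) * Real.pi / (n + 1 : ℕ)))))]
  refine Finset.sum_congr rfl fun i _ => ?_
  rw [mode_eq, mode_eq]
  have := Real.mul_self_sqrt (show (0 : ℝ) ≤ 2 by norm_num)
  linear_combination (Real.sin (((i + 1 : ℕ) : ℝ) * ((k + 1 : ℕ) * Real.pi / (n + 1 : ℕ))) *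
    Real.sin (((i + 1 : ℕ) : ℝ) * ((l + 1 : ℕ) * Real.pi / (n + 1 : ℕ)))) * this

/-- The eigenvalues of the central difference matrix. -/
noncomputable def discEig (N k : ℕ) : ℝ := 4 * (N : ℝ) ^ 2 * Real.sin (k * Real.pi / (2 * N)) ^ 2

/-- The zeros of `F` at `0` and `N` play the neighbours missing in the first and last rows. -/
theorem diffMatrix_mulVec_apply {N : ℕ} {F : ℕ → ℝ} (h0 : F 0 = 0) (hN : F N = 0)
    (i : Fin (N - 1)) :
    (diffMatrix N).mulVec (fun j => F (j + 1)) i =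
      (N : ℝ) ^ 2 * (2 * F (i + 1) - F i - F (i + 2)) := by
  have hi := i.2
  simp only [Matrix.mulVec, dotProduct, diffMatrix, Matrix.of_apply, mul_assoc, Fin.ext_iff]
  rw [← Finset.mul_sum, Fin.sum_univ_eq_sum_range (fun j => (if (i : ℕ) = j then (2 : ℝ) else
    if (i : ℕ) + 1 = j ∨ j + 1 = i then -1 else 0) * F (j + 1))]
  congr 1
  have e : ∀ j ∈ Finset.range (N - 1), (if (i : ℕ) = j then (2 : ℝ) else
      if (i : ℕ) + 1 = j ∨ j + 1 = i then -1 else 0) * F (j + 1) =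
      (if (i : ℕ) = j then 2 * F (j + 1) else 0) - (if (i : ℕ) + 1 = j then F (j + 1) else 0) -
        (if j + 1 = i then F (j + 1) else 0) := by
    intro j _
    split_ifs <;> first | omega | ring
  rw [Finset.sum_congr rfl e, Finset.sum_sub_distrib, Finset.sum_sub_distrib, Finset.sum_ite_eq,
    Finset.sum_ite_eq, if_pos (Finset.mem_range.2 hi)]
  have h1 : (if (i : ℕ) + 1 ∈ Finset.range (N - 1) then F (i + 1 + 1) else 0) = F (i + 2) := by
    split_ifs with h
    · rfl
    · rw [Finset.mem_range] at h
      rw [show (i : ℕ) + 2 = N by omega, hN]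
  have h2 : ∑ j ∈ Finset.range (N - 1), (if j + 1 = (i : ℕ) then F (j + 1) else 0) = F i := by
    rcases Nat.eq_zero_or_pos (i : ℕ) with h | h
    · rw [h, h0]
      exact Finset.sum_eq_zero fun j _ => if_neg (by omega)
    · rw [Finset.sum_eq_single ((i : ℕ) - 1)]
      · rw [if_pos (by omega)]
        congr 1
        omega
      · intro j _ hj
        exact if_neg (by omega)
      · intro hj
        rw [Finset.mem_range] at hj
        omega
  rw [h1, h2]
  ring

/-- The second difference multiplies the sine by `2 - 2 cos θ = 4 sin²(θ/2)`, `θ = kπ/N`. It holds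
for every `k`, as the sine vanishes at both boundary nodes. -/
theorem diffMatrix_mulVec_mode (N k : ℕ) :
    (diffMatrix N).mulVec (mode N k) = discEig N k • mode N k := by
  funext i
  have hN : (N : ℝ) ≠ 0 := by
    have := i.2
    have : N ≠ 0 := by omega
    exact_mod_cast this
  have h := diffMatrix_mulVec_apply (N := N)
    (F := fun j => Real.sqrt 2 * Real.sin (j * (k * Real.pi / N))) (by simp)
    (by rw [mul_div_cancel₀ _ hN, Real.sin_nat_mul_pi, mul_zero]) i
  have e : mode N k = fun j : Fin (N - 1) =>
      Real.sqrt 2 * Real.sin (((j + 1 : ℕ) : ℝ) * (k * Real.pi / N)) := funext (mode_eq N k)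
  rw [e, h, Pi.smul_apply, smul_eq_mul, discEig]
  set θ := k * Real.pi / N with hθ
  have h1 : k * Real.pi / (2 * N) = θ / 2 := by rw [hθ]; ring
  have h2 : ((i : ℕ) : ℝ) * θ = ((i + 1 : ℕ) : ℝ) * θ - θ := by push_cast; ring
  have h3 : ((i + 2 : ℕ) : ℝ) * θ = ((i + 1 : ℕ) : ℝ) * θ + θ := by push_cast; ring
  have h4 : Real.cos θ = 1 - 2 * Real.sin (θ / 2) ^ 2 := by
    rw [← Real.cos_sq_add_sin_sq (θ / 2), show θ = 2 * (θ / 2) by ring, Real.cos_two_mul,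
      show 2 * (θ / 2) / 2 = θ / 2 by ring]
    linarith [Real.cos_sq_add_sin_sq (θ / 2)]
  rw [h1, h2, h3, Real.sin_sub, Real.sin_add, h4]
  ring

theorem diffMatrix_transpose (N : ℕ) : (diffMatrix N).transpose = diffMatrix N := by
  ext i j
  simp only [diffMatrix, Matrix.transpose_apply, Matrix.of_apply, eq_comm (a := j), or_comm]

/-! ### Representation of the scheme solution -/

theorem HasRLDeriv.sum {α T t : ℝ} (hα1 : α < 1) {ι : Type*} (s : Finset ι) {g : ι → ℝ → ℝ}
    {d : ι → ℝ} (hg : ∀ i, HasRLDeriv α T (g i) (d i) t)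
    (hc : ∀ i, ContinuousOn (g i) (Icc 0 T)) (ht : t ∈ Icc 0 T) (a : ι → ℝ) :
    HasRLDeriv α T (fun x => ∑ i ∈ s, a i * g i x) (∑ i ∈ s, a i * d i) t := by
  classical
  induction s using Finset.induction_on with
  | empty =>
    simp only [Finset.sum_empty]
    refine HasDerivWithinAt.congr_of_mem (hasDerivWithinAt_const t _ (0 : ℝ)) (fun x _ => ?_) ht
    simp [rlPrimitive]
  | insert i s hi ih =>
    simp only [Finset.sum_insert hi]
    have := (hg i).linear hα1 ih (hc i)
      (continuousOn_finsetSum _ fun j _ => continuousOn_const.mul (hc j)) ht (a i) 1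
    simpa only [one_mul] using this

theorem spectralProj_node (N : ℕ) (v : ℝ → ℝ) (i : Fin (N - 1)) :
    nodal N (spectralProj N v) i =
      ∑ k : Fin (N - 1), pairing v (eigfun (k + 1)) * mode N (k + 1) i := by
  rw [nodal, spectralProj, Fin.sum_univ_eq_sum_range
    (fun k => pairing v (eigfun (k + 1)) * mode N (k + 1) i), Finset.range_eq_Ico,
    Finset.sum_Ico_add' (fun k => pairing v (eigfun k) * mode N k i) 0 (N - 1) 1]
  rfl

/-- Testing with a mode and moving the symmetric matrix onto it decouples the system into scalar
equations, solved by uniqueness. -/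
theorem IsModifiedSchemeSolution.eq_sum {α T : ℝ} {N : ℕ} {u₀ : ℝ → ℝ}
    {U : ℝ → Fin (N - 1) → ℝ} (hα : 0 < α) (hα1 : α < 1) (hT : 0 < T)
    (hU : IsModifiedSchemeSolution α T N u₀ (fun _ _ => 0) U) {t : ℝ} (ht : t ∈ Icc 0 T)
    (i : Fin (N - 1)) :
    U t i = ∑ k : Fin (N - 1), pairing u₀ (eigfun (k + 1)) *
      ml α (discEig N (k + 1) * t ^ α) * mode N (k + 1) i := by
  have hN : (N : ℝ) ≠ 0 := by
    have := i.2
    have : N ≠ 0 := by omega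
    exact_mod_cast this
  have hUc : ∀ j, ContinuousOn (fun s => U s j) (Icc 0 T) :=
    fun j => (continuous_apply j).comp_continuousOn hU.continuous_time
  -- The initial vector samples only modes below `N`, so its discrete coefficients are the exact
  -- ones, free of aliasing.
  have hP0 : ∀ k : Fin (N - 1),
      ∑ j, 1 / (N : ℝ) * mode N (k + 1) j * nodal N (spectralProj N u₀) j =
        pairing u₀ (eigfun (k + 1)) := by
    intro k
    simp_rw [spectralProj_node, Finset.mul_sum]
    rw [Finset.sum_comm]
    have : ∀ l : Fin (N - 1), ∑ j, 1 / (N : ℝ) * mode N (k + 1) j *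
        (pairing u₀ (eigfun (l + 1)) * mode N (l + 1) j) =
        if k = l then pairing u₀ (eigfun (l + 1)) else 0 := by
      intro l
      have h := sum_mode_mul_mode k l
      calc _ = 1 / (N : ℝ) * pairing u₀ (eigfun (l + 1)) *
            ∑ j, mode N (k + 1) j * mode N (l + 1) j := by
            rw [Finset.mul_sum]
            exact Finset.sum_congr rfl fun j _ => by ring
        _ = _ := by
            rw [h]
            split_ifs
            · field_simp
            · ring
    simp_rw [this]
    simp
  have hcoef : ∀ k : Fin (N - 1), ∑ j, 1 / (N : ℝ) * mode N (k + 1) j * U t j =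
      pairing u₀ (eigfun (k + 1)) * ml α (discEig N (k + 1) * t ^ α) := by
    intro k
    refine eq_mul_ml_of_hasRLDeriv (T := T)
      (y := fun s => ∑ j, 1 / (N : ℝ) * mode N (k + 1) j * U s j) hα hα1
      (by unfold discEig; positivity) hT
      (continuousOn_finsetSum _ fun j _ => continuousOn_const.mul (hUc j)) ?_ ?_ t ht
    · simp only [hU.initial, hP0]
    · intro s hs
      have h := HasRLDeriv.sum hα1 Finset.univ (hU.equation s hs)
        (fun j => (hUc j).sub continuousOn_const) (Ioc_subset_Icc_self hs)
        (fun j => 1 / (N : ℝ) * mode N (k + 1) j)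
      have e1 : (fun x => ∑ j, 1 / (N : ℝ) * mode N (k + 1) j * U x j -
          pairing u₀ (eigfun (k + 1))) = fun x => ∑ j, 1 / (N : ℝ) * mode N (k + 1) j *
            (U x j - nodal N (spectralProj N u₀) j) := by
        funext x
        rw [← hP0 k, ← Finset.sum_sub_distrib]
        exact Finset.sum_congr rfl fun j _ => by ring
      have e2 : ∑ j, 1 / (N : ℝ) * mode N (k + 1) j * (nodal N (spectralProj N fun _ => 0) j -
          (diffMatrix N).mulVec (U s) j) =
          -discEig N (k + 1) * ∑ j, 1 / (N : ℝ) * mode N (k + 1) j * U s j := by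
        have hz : ∀ j, nodal N (spectralProj N fun _ => 0) j = 0 := fun j => by
          rw [spectralProj_node]
          simp [pairing]
        have hd : mode N (k + 1) ⬝ᵥ (diffMatrix N).mulVec (U s) =
            discEig N (k + 1) * (mode N (k + 1) ⬝ᵥ U s) := by
          rw [Matrix.dotProduct_mulVec, ← Matrix.mulVec_transpose, diffMatrix_transpose,
            diffMatrix_mulVec_mode, smul_dotProduct, smul_eq_mul]
        simp only [dotProduct] at hd
        simp_rw [hz, zero_sub, mul_assoc, ← Finset.mul_sum]
        rw [Finset.sum_congr rfl fun j _ => mul_neg (mode N (k + 1) j) _,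
          Finset.sum_neg_distrib, hd]
        ring
      rw [e1, ← e2]
      exact h
  -- Recover `U t i` from its discrete coefficients by column orthogonality.
  simp_rw [← hcoef, Finset.sum_mul]
  rw [Finset.sum_comm]
  have : ∀ j, ∑ k : Fin (N - 1), 1 / (N : ℝ) * mode N (k + 1) j * U t j * mode N (k + 1) i =
      if j = i then U t j else 0 := by
    intro j
    have h := sum_mode_mul_mode j i
    calc _ = 1 / (N : ℝ) * U t j * ∑ k, mode N (j + 1) k * mode N (i + 1) k := by
          rw [Finset.mul_sum]
          refine Finset.sum_congr rfl fun k _ => ?_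
          rw [mode_symm N j k, mode_symm N i k]
          ring
      _ = _ := by
          rw [h]
          split_ifs
          · field_simp
          · ring
  simp_rw [this]
  simp

/-! ### Sine series on the unit interval -/

theorem continuous_eigfun (k : ℕ) : Continuous (eigfun k) := by
  unfold eigfun
  fun_prop

theorem abs_eigfun_le (k : ℕ) (x : ℝ) : |eigfun k x| ≤ Real.sqrt 2 := by
  rw [eigfun, abs_mul, abs_of_nonneg (Real.sqrt_nonneg 2)]
  exact mul_le_of_le_one_right (Real.sqrt_nonneg 2) (Real.abs_sin_le_one _)

theorem eigfun_zero (k : ℕ) : eigfun k 0 = 0 := by simp [eigfun]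

theorem eigfun_one (k : ℕ) : eigfun k 1 = 0 := by
  simp [eigfun, Real.sin_nat_mul_pi]

theorem pairing_eq_setIntegral (v w : ℝ → ℝ) :
    pairing v w = ∫ x in Ioo (0 : ℝ) 1, v x * w x := by
  rw [pairing, intervalIntegral.integral_of_le zero_le_one, integral_Ioc_eq_integral_Ioo]

/-- A continuous function on `[0,1]` that vanishes at the ends and is orthogonal to all sines
vanishes. -/
theorem eq_zero_of_pairing_eigfun_eq_zero {f : ℝ → ℝ} (hf : ContinuousOn f (Icc 0 1))
    (h0 : f 0 = 0) (h1 : f 1 = 0) (h : ∀ k : ℕ, pairing f (eigfun (k + 1)) = 0) :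
    ∀ x ∈ Icc (0 : ℝ) 1, f x = 0 := by
  have : Fact ((0 : ℝ) < 2) := ⟨two_pos⟩
  set F : ℝ → ℝ := fun x => f (max 0 (min 1 x)) with hF
  have hFc : Continuous F := hf.comp_continuous (by fun_prop)
    fun x => ⟨le_max_left _ _, max_le zero_le_one (min_le_left _ _)⟩
  have hF1 : ∀ x ∈ Icc (0 : ℝ) 1, F x = f x := fun x hx => by
    simp only [hF, min_eq_right hx.2, max_eq_right hx.1]
  have hF2 : ∀ x ≤ (0 : ℝ), F x = 0 := fun x hx => by
    simp only [hF, min_eq_right (hx.trans zero_le_one), max_eq_left hx, h0]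
  -- On `[-1, 1]` this is the odd extension of `f`: `F` is zero on the left half. Its period-2
  -- Fourier coefficients reduce to the sine integrals.
  set g : ℝ → ℂ := fun x => ((F x - F (-x) : ℝ) : ℂ) with hg
  have hgc : Continuous g := by fun_prop
  have hgodd : ∀ x, g (-x) = -g x := fun x => by
    simp only [hg, neg_neg]
    push_cast
    ring
  have hgf : ∀ x ∈ Icc (0 : ℝ) 1, g x = f x := fun x hx => by
    simp only [hg, hF1 x hx, hF2 (-x) (by linarith [hx.1]), sub_zero]
  have hgend : g (-1) = g (-1 + 2) := by
    rw [hgodd, show (-1 + 2 : ℝ) = 1 by norm_num, hgf 1 ⟨zero_le_one, le_rfl⟩, h1]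
    simp
  have hGc : Continuous (AddCircle.liftIco (2 : ℝ) (-1) g) :=
    AddCircle.liftIco_continuous hgend hgc.continuousOn
  have hsin : ∀ k : ℕ, ∫ x in (0 : ℝ)..1, Real.sin (k * Real.pi * x) * f x = 0 := by
    intro k
    rcases k with _ | k
    · simp
    · have h2 := h k
      have e : (fun x => f x * eigfun (k + 1) x) =
          fun x => Real.sqrt 2 * (Real.sin ((k + 1 : ℕ) * Real.pi * x) * f x) := by
        funext x
        rw [eigfun]
        ring
      rw [pairing, e, intervalIntegral.integral_const_mul, mul_eq_zero] at h2
      exact h2.resolve_left (by positivity)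
  have hsinz : ∀ n : ℤ, ∫ x in (0 : ℝ)..1, Real.sin (n * Real.pi * x) * f x = 0 := by
    intro n
    obtain ⟨k, rfl | rfl⟩ := n.eq_nat_or_neg
    · exact_mod_cast hsin k
    · have e : (fun x => Real.sin (((-(k : ℤ) : ℤ) : ℝ) * Real.pi * x) * f x) =
          fun x => -(Real.sin (k * Real.pi * x) * f x) := by
        funext x
        rw [← neg_mul, ← Real.sin_neg]
        congr 2
        push_cast
        ring
      rw [e, intervalIntegral.integral_neg, hsin, neg_zero]
  have hcoef : ∀ n : ℤ, fourierCoeff (AddCircle.liftIco (2 : ℝ) (-1) g) n = 0 := by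
    intro n
    rw [fourierCoeff_liftIco_eq, fourierCoeffOn_eq_integral]
    rw [show (-1 + 2 - -1 : ℝ) = 2 by norm_num, show (-1 + 2 : ℝ) = 1 by norm_num]
    have hFcont : Continuous fun x : ℝ => (fourier (-n) (x : AddCircle (2 : ℝ))) • g x := by
      have : Continuous fun x : ℝ => (fourier (-n) (x : AddCircle (2 : ℝ))) :=
        (ContinuousMap.continuous _).comp (AddCircle.continuous_mk' _)
      exact this.smul hgc
    rw [← intervalIntegral.integral_add_adjacent_intervals (b := 0)
      (hFcont.intervalIntegrable _ _) (hFcont.intervalIntegrable _ _)]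
    have hneg := intervalIntegral.integral_comp_neg (a := 0) (b := 1)
      fun x : ℝ => (fourier (-n) (x : AddCircle (2 : ℝ))) • g x
    rw [neg_zero] at hneg
    have hFneg : Continuous fun x : ℝ =>
        (fourier (-n) ((-x : ℝ) : AddCircle (2 : ℝ))) • g (-x) := hFcont.comp continuous_neg
    rw [← hneg, ← intervalIntegral.integral_add
      (hFneg.intervalIntegrable _ _) (hFcont.intervalIntegrable _ _)]
    have e : ∫ x in (0 : ℝ)..1, ((fourier (-n) ((-x : ℝ) : AddCircle (2 : ℝ))) • g (-x) +
        (fourier (-n) (x : AddCircle (2 : ℝ))) • g x) =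
        ∫ x in (0 : ℝ)..1, (-2 * Complex.I) * ((Real.sin (n * Real.pi * x) * f x : ℝ) : ℂ) := by
      refine intervalIntegral.integral_congr fun x hx => ?_
      rw [uIcc_of_le zero_le_one] at hx
      simp only [smul_eq_mul, hgodd, hgf x hx, fourier_coe_apply]
      have e1 : 2 * (Real.pi : ℂ) * Complex.I * ((-n : ℤ) : ℂ) * ((-x : ℝ) : ℂ) / ((2 : ℝ) : ℂ) =
          ((n * Real.pi * x : ℝ) : ℂ) * Complex.I := by push_cast; ring
      have e2 : 2 * (Real.pi : ℂ) * Complex.I * ((-n : ℤ) : ℂ) * (x : ℂ) / ((2 : ℝ) : ℂ) =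
          ((-(n * Real.pi * x) : ℝ) : ℂ) * Complex.I := by push_cast; ring
      rw [e1, e2, Complex.exp_mul_I, Complex.exp_mul_I, ← Complex.ofReal_cos, ← Complex.ofReal_sin,
        ← Complex.ofReal_cos, ← Complex.ofReal_sin, Real.cos_neg, Real.sin_neg]
      push_cast
      ring
    rw [e, intervalIntegral.integral_const_mul, intervalIntegral.integral_ofReal, hsinz]
    simp
  have hG0 : ∀ y : AddCircle (2 : ℝ), AddCircle.liftIco (2 : ℝ) (-1) g y = 0 := by
    intro y
    have hs : fourierCoeff (AddCircle.liftIco (2 : ℝ) (-1) g) = 0 := funext hcoef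
    -- Zero coefficients are summable, so the continuous periodic function equals its Fourier
    -- series, which is zero.
    have h2 := has_pointwise_sum_fourier_series_of_summable (T := 2)
      (f := ⟨AddCircle.liftIco (2 : ℝ) (-1) g, hGc⟩)
      (by simp only [ContinuousMap.coe_mk, hs]; exact summable_zero) y
    simp only [ContinuousMap.coe_mk, hs, Pi.zero_apply, zero_smul] at h2
    exact h2.unique hasSum_zero
  intro x hx
  rcases hx.2.eq_or_lt with h2 | h2
  · rw [h2, h1]
  · have h3 := hG0 (x : AddCircle (2 : ℝ))
    rw [AddCircle.liftIco_coe_apply ⟨by linarith [hx.1], by linarith⟩, hgf x hx] at h3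
    exact_mod_cast h3

theorem integral_cos_int_mul_pi (m : ℤ) :
    ∫ x in (0 : ℝ)..1, Real.cos (m * Real.pi * x) = if m = 0 then 1 else 0 := by
  split_ifs with h
  · simp [h]
  · have h' : (m : ℝ) * Real.pi ≠ 0 := mul_ne_zero (by exact_mod_cast h) Real.pi_ne_zero
    rw [intervalIntegral.integral_comp_mul_left Real.cos h', integral_cos]
    simp [Real.sin_int_mul_pi]

theorem pairing_eigfun_eigfun (k l : ℕ) :
    pairing (eigfun (k + 1)) (eigfun (l + 1)) = if k = l then 1 else 0 := by
  have e : (fun x => eigfun (k + 1) x * eigfun (l + 1) x) = fun x =>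
      Real.cos ((((k : ℤ) - l : ℤ) : ℝ) * Real.pi * x) -
        Real.cos ((((k : ℤ) + l + 2 : ℤ) : ℝ) * Real.pi * x) := by
    funext x
    have h1 : (((k : ℤ) - l : ℤ) : ℝ) * Real.pi * x =
        ((k + 1 : ℕ) : ℝ) * Real.pi * x - ((l + 1 : ℕ) : ℝ) * Real.pi * x := by push_cast; ring
    have h2 : (((k : ℤ) + l + 2 : ℤ) : ℝ) * Real.pi * x =
        ((k + 1 : ℕ) : ℝ) * Real.pi * x + ((l + 1 : ℕ) : ℝ) * Real.pi * x := by push_cast; ring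
    rw [h1, h2, Real.cos_sub, Real.cos_add, eigfun, eigfun]
    have := Real.mul_self_sqrt (show (0 : ℝ) ≤ 2 by norm_num)
    linear_combination (Real.sin (((k + 1 : ℕ) : ℝ) * Real.pi * x) *
      Real.sin (((l + 1 : ℕ) : ℝ) * Real.pi * x)) * this
  rw [pairing, e, intervalIntegral.integral_sub
    (Continuous.intervalIntegrable (by fun_prop) _ _)
    (Continuous.intervalIntegrable (by fun_prop) _ _), integral_cos_int_mul_pi,
    integral_cos_int_mul_pi, if_neg (show (k : ℤ) + l + 2 ≠ 0 by omega), sub_zero]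
  simp only [sub_eq_zero, Nat.cast_inj]

theorem pairing_tsum_eigfun {a : ℕ → ℝ} (ha : Summable a) (l : ℕ) :
    pairing (fun x => ∑' k, a k * eigfun (k + 1) x) (eigfun (l + 1)) = a l := by
  have hb : ∀ k x, ‖a k * eigfun (k + 1) x‖ ≤ ‖a k‖ * Real.sqrt 2 := fun k x => by
    rw [norm_mul]
    exact mul_le_mul_of_nonneg_left (abs_eigfun_le _ _) (norm_nonneg _)
  have hs : Summable fun k => ‖a k‖ * Real.sqrt 2 := ha.norm.mul_right _
  have key := intervalIntegral.hasSum_integral_of_dominated_convergence (a := 0) (b := 1)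
    (μ := volume) (F := fun k x => a k * eigfun (k + 1) x * eigfun (l + 1) x)
    (f := fun x => (∑' k, a k * eigfun (k + 1) x) * eigfun (l + 1) x)
    (fun k _ => ‖a k‖ * Real.sqrt 2 * Real.sqrt 2)
    (fun k => (((continuous_const.mul (continuous_eigfun _)).mul
      (continuous_eigfun _)).aestronglyMeasurable))
    (fun k => Eventually.of_forall fun x _ => by
      rw [norm_mul]
      exact mul_le_mul (hb k x) (abs_eigfun_le _ _) (norm_nonneg _) (by positivity))
    (Eventually.of_forall fun x _ => hs.mul_right _)
    intervalIntegrable_const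
    (Eventually.of_forall fun x _ => (Summable.of_norm_bounded hs fun k => hb k x).hasSum.mul_right _)
  have e : ∀ k, ∫ x in (0 : ℝ)..1, a k * eigfun (k + 1) x * eigfun (l + 1) x =
      if k = l then a l else 0 := by
    intro k
    simp_rw [mul_assoc]
    rw [intervalIntegral.integral_const_mul]
    have := pairing_eigfun_eigfun k l
    rw [pairing] at this
    rw [this]
    split_ifs with h
    · rw [h, mul_one]
    · rw [mul_zero]
  simp_rw [e] at key
  exact key.unique (hasSum_ite_eq l (a l))

/-- Pointwise sine series of a continuous function with summable coefficients. -/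
theorem hasSum_eigfun_of_summable {f : ℝ → ℝ} (hf : ContinuousOn f (Icc 0 1))
    (h0 : f 0 = 0) (h1 : f 1 = 0) (h : Summable fun k : ℕ => pairing f (eigfun (k + 1)))
    {x : ℝ} (hx : x ∈ Icc (0 : ℝ) 1) :
    HasSum (fun k : ℕ => pairing f (eigfun (k + 1)) * eigfun (k + 1) x) (f x) := by
  set a : ℕ → ℝ := fun k => pairing f (eigfun (k + 1)) with ha
  have hb : ∀ k x, ‖a k * eigfun (k + 1) x‖ ≤ ‖a k‖ * Real.sqrt 2 := fun k x => by
    rw [norm_mul]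
    exact mul_le_mul_of_nonneg_left (abs_eigfun_le _ _) (norm_nonneg _)
  have hs : Summable fun k => ‖a k‖ * Real.sqrt 2 := h.norm.mul_right _
  have hSc : Continuous fun x => ∑' k, a k * eigfun (k + 1) x :=
    continuous_tsum (fun k => continuous_const.mul (continuous_eigfun _)) hs hb
  -- Compare `f` with the sum of its sine series, continuous by uniform convergence: the difference
  -- is orthogonal to every sine.
  have hz := eq_zero_of_pairing_eigfun_eq_zero (f := fun x => f x - ∑' k, a k * eigfun (k + 1) x)
    (hf.sub hSc.continuousOn) (by simp [h0, eigfun_zero]) (by simp [h1, eigfun_one])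
    (fun l => by
      have e := pairing_tsum_eigfun h l
      rw [pairing] at e ⊢
      simp_rw [sub_mul]
      rw [intervalIntegral.integral_sub, e]
      · exact sub_self _
      · refine ContinuousOn.intervalIntegrable ?_
        rw [uIcc_of_le zero_le_one]
        exact hf.mul (continuous_eigfun _).continuousOn
      · exact (hSc.mul (continuous_eigfun _)).intervalIntegrable _ _) x hx
  rw [sub_eq_zero.1 hz]
  exact (Summable.of_norm_bounded hs fun k => hb k x).hasSum

theorem InL2.intervalIntegrable {v : ℝ → ℝ} (hv : InL2 v) :
    IntervalIntegrable v volume 0 1 := by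
  rw [intervalIntegrable_iff_integrableOn_Ioo_of_le zero_le_one]
  exact MemLp.integrable one_le_two hv

theorem InL2.pairing_sub {v w : ℝ → ℝ} (hv : InL2 v) (hw : InL2 w) (k : ℕ) :
    pairing (fun x => v x - w x) (eigfun k) = pairing v (eigfun k) - pairing w (eigfun k) := by
  simp only [pairing, sub_mul]
  exact intervalIntegral.integral_sub
    (hv.intervalIntegrable.mul_continuousOn (continuous_eigfun k).continuousOn)
    (hw.intervalIntegrable.mul_continuousOn (continuous_eigfun k).continuousOn)

theorem contDiff_eigfun (k : ℕ) : ContDiff ℝ ∞ (eigfun k) := by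
  unfold eigfun
  fun_prop

theorem deriv_deriv_eigfun (k : ℕ) (x : ℝ) :
    deriv (deriv (eigfun k)) x = -eigval k * eigfun k x := by
  have h1 : deriv (eigfun k) = fun x => Real.sqrt 2 *
      (Real.cos ((k : ℝ) * Real.pi * x) * ((k : ℝ) * Real.pi)) := by
    funext y
    have := ((((hasDerivAt_id y).const_mul ((k : ℝ) * Real.pi)).sin).const_mul (Real.sqrt 2)).deriv
    simp only [id_eq, mul_one] at this
    exact this
  have h2 := (((((hasDerivAt_id x).const_mul ((k : ℝ) * Real.pi)).cos).mul_const
    ((k : ℝ) * Real.pi)).const_mul (Real.sqrt 2)).deriv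
  rw [h1]
  simp only [id_eq, mul_one] at h2
  rw [h2, eigval, eigfun]
  ring

/-! ### Sine coefficients of the exact solution -/

theorem IsSolution.continuousOn_pairing {α T : ℝ} {u₀ : ℝ → ℝ} {f u : ℝ → ℝ → ℝ}
    (hu : IsSolution α T u₀ f u) (k : ℕ) :
    ContinuousOn (fun t => pairing (u t) (eigfun k)) (Icc 0 T) := by
  intro s hs
  simp only [ContinuousWithinAt, pairing_eq_setIntegral]
  have hint : ∀ t ∈ Icc 0 T, Integrable (fun x => u t x * eigfun k x)
      (volume.restrict (Ioo (0 : ℝ) 1)) := fun t ht => by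
    have h := (hu.memL2 t ht).intervalIntegrable.mul_continuousOn
      (continuous_eigfun k).continuousOn
    rwa [intervalIntegrable_iff_integrableOn_Ioo_of_le zero_le_one] at h
  have : IsProbabilityMeasure (volume.restrict (Ioo (0 : ℝ) 1)) := ⟨by simp⟩
  refine tendsto_integral_of_L1' _ (hint s hs).aestronglyMeasurable ?_ ?_
  · filter_upwards [self_mem_nhdsWithin] with t ht using hint t ht
  · have hlim := ENNReal.Tendsto.const_mul (a := ENNReal.ofReal (Real.sqrt 2))
      (hu.continuous_time s hs) (Or.inr ENNReal.ofReal_ne_top)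
    rw [mul_zero] at hlim
    refine tendsto_of_tendsto_of_tendsto_of_le_of_le' tendsto_const_nhds hlim
      (Eventually.of_forall fun _ => zero_le) ?_
    filter_upwards [self_mem_nhdsWithin] with t ht
    have hm : AEStronglyMeasurable (fun x => u t x - u s x) (volume.restrict (Ioo (0 : ℝ) 1)) :=
      (hu.memL2 t ht).aestronglyMeasurable.sub (hu.memL2 s hs).aestronglyMeasurable
    refine (eLpNorm_le_mul_eLpNorm_of_ae_le_mul (g := fun x => u t x - u s x)
      (Eventually.of_forall fun x => ?_) 1).trans
      (mul_le_mul_right (eLpNorm_le_eLpNorm_of_exponent_le one_le_two hm) _)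
    rw [Pi.sub_apply, ← sub_mul, norm_mul, mul_comm]
    exact mul_le_mul_of_nonneg_right (abs_eigfun_le k x) (norm_nonneg _)

/-- Each eigenfunction is an admissible test function, so each coefficient solves the scalar
equation. -/
theorem IsSolution.pairing_eq {α T : ℝ} {u₀ : ℝ → ℝ} {u : ℝ → ℝ → ℝ} (hα : 0 < α) (hα1 : α < 1)
    (hT : 0 < T) (hu₀ : InL2 u₀) (hu : IsSolution α T u₀ (fun _ _ => 0) u) (k : ℕ) {t : ℝ}
    (ht : t ∈ Icc 0 T) :
    pairing (u t) (eigfun k) = pairing u₀ (eigfun k) * ml α (eigval k * t ^ α) := by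
  refine eq_mul_ml_of_hasRLDeriv (T := T) (y := fun s => pairing (u s) (eigfun k)) hα hα1
    (by unfold eigval; positivity) hT (hu.continuousOn_pairing k) ?_ ?_ t ht
  · simp only [pairing_eq_setIntegral]
    refine integral_congr_ae ?_
    filter_upwards [hu.initial] with x hx
    rw [hx]
  · intro s hs
    have h := hu.equation (eigfun k) (contDiff_eigfun k) (eigfun_zero k) (eigfun_one k) s hs
    have e : pairing (fun _ => 0) (eigfun k) - pairing (u s)
        (fun x => -deriv (deriv (eigfun k)) x) = -eigval k * pairing (u s) (eigfun k) := by
      have e2 : (fun x => u s x * -deriv (deriv (eigfun k)) x) =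
          fun x => eigval k * (u s x * eigfun k x) := by
        funext x
        rw [deriv_deriv_eigfun]
        ring
      rw [pairing, pairing, e2, intervalIntegral.integral_const_mul, pairing]
      simp
    rw [e] at h
    exact h.congr (fun r hr => ((hu.memL2 r hr).pairing_sub hu₀ k).symm)
      (Ioc_subset_Icc_self hs)

/-! ### Continuous against discrete eigenvalues -/

theorem eigval_eq_sq {N : ℕ} (hN : 0 < N) (k : ℕ) :
    eigval k = 4 * (N : ℝ) ^ 2 * (k * Real.pi / (2 * N)) ^ 2 := by
  have : (N : ℝ) ≠ 0 := by exact_mod_cast hN.ne'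
  unfold eigval
  field_simp
  ring

theorem discEig_le_eigval {N : ℕ} (hN : 0 < N) (k : ℕ) : discEig N k ≤ eigval k := by
  rw [eigval_eq_sq hN, discEig]
  refine mul_le_mul_of_nonneg_left ?_ (by positivity)
  have hx : 0 ≤ k * Real.pi / (2 * N) := by positivity
  refine sq_le_sq' ?_ (Real.sin_le hx)
  have := (abs_le.1 (Real.abs_sin_le_abs (x := k * Real.pi / (2 * N)))).1
  rwa [abs_of_nonneg hx] at this

/-- Jordan's inequality `sin x ≥ 2x/π` on `[0, π/2]` gives the ratio `π²/4 ≤ 3`. -/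
theorem eigval_le_three_mul_discEig {N k : ℕ} (hN : 0 < N) (hk : k ≤ N) :
    eigval k ≤ 3 * discEig N k := by
  have hN' : (0 : ℝ) < N := by exact_mod_cast hN
  have hk' : (k : ℝ) ≤ N := by exact_mod_cast hk
  have hpi := Real.pi_pos
  rw [eigval_eq_sq hN, discEig]
  set x := k * Real.pi / (2 * N) with hx
  have hx0 : 0 ≤ x := by positivity
  have hx1 : x ≤ Real.pi / 2 := by
    rw [hx, div_le_div_iff₀ (by positivity) two_pos]
    nlinarith
  have h1 := Real.mul_le_sin hx0 hx1
  have h2 : (2 / Real.pi * x) ^ 2 ≤ Real.sin x ^ 2 := pow_le_pow_left₀ (by positivity) h1 2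
  have h3 : x ^ 2 ≤ 3 * (2 / Real.pi * x) ^ 2 := by
    have h4 : Real.pi ^ 2 ≤ 12 := by nlinarith [Real.pi_lt_d2]
    rw [mul_pow (2 / Real.pi) x, div_pow 2 Real.pi, ← mul_assoc, ← mul_div_assoc]
    refine le_mul_of_one_le_left (sq_nonneg x) ?_
    rw [one_le_div (by positivity)]
    linarith
  nlinarith [sq_nonneg (N : ℝ)]

/-- `x² - sin² x = (x - sin x)(x + sin x) ≤ (x³/6)(2x)`. -/
theorem eigval_sub_discEig_le {N : ℕ} (hN : 0 < N) (k : ℕ) :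
    eigval k - discEig N k ≤ eigval k ^ 2 / (12 * N ^ 2) := by
  have hN' : (0 : ℝ) < N := by exact_mod_cast hN
  rw [eigval_eq_sq hN, discEig]
  set x := k * Real.pi / (2 * N) with hx
  have hx0 : 0 ≤ x := by positivity
  have h1 : x ^ 2 - Real.sin x ^ 2 ≤ x ^ 4 / 3 := by
    rcases hx0.eq_or_lt with h | h
    · simp [← h]
    · have h2 := Real.sin_gt_sub_cube h
      have h3 := Real.sin_le hx0
      have h4 := (abs_le.1 (Real.abs_sin_le_abs (x := x))).1
      rw [abs_of_nonneg hx0] at h4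
      have h5 : (x - Real.sin x) * (x + Real.sin x) ≤ x ^ 3 / 6 * (2 * x) :=
        mul_le_mul (by linarith) (by linarith) (by linarith) (by positivity)
      linarith
  have e : (4 * (N : ℝ) ^ 2 * x ^ 2) ^ 2 / (12 * N ^ 2) = 4 * N ^ 2 * (x ^ 4 / 3) := by
    field_simp
    ring
  rw [e, ← mul_sub]
  exact mul_le_mul_of_nonneg_left h1 (by positivity)

theorem sq_le_eigval (k : ℕ) : (k : ℝ) ^ 2 ≤ eigval k := by
  unfold eigval
  have : (1 : ℝ) ≤ Real.pi ^ 2 := by nlinarith [Real.pi_gt_three]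
  exact le_mul_of_one_le_right (sq_nonneg _) this

/-- The eigenvalue error grows like `λ²` and `ml_sub_le` gains `λ^{-2}`, so the bound is uniform in
`k`. The constant is `4 · 9/12 = 3`. -/
theorem abs_ml_sub_ml_discEig_le {α s : ℝ} (hα : 0 < α) (hα1 : α < 1) (hs : 0 < s) {N k : ℕ}
    (hk : 0 < k) (hkN : k ≤ N) :
    |ml α (eigval k * s) - ml α (discEig N k * s)| ≤
      3 * (1 / Real.Gamma (2 - α)) / (N : ℝ) ^ 2 * s⁻¹ := by
  have hN : 0 < N := hk.trans_le hkN
  have hN' : (0 : ℝ) < N := by exact_mod_cast hN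
  have hk' : (0 : ℝ) < k := by exact_mod_cast hk
  have h1 := discEig_le_eigval hN k
  have h2 := eigval_le_three_mul_discEig hN hkN
  have h3 := eigval_sub_discEig_le hN k
  have hlam : 0 < eigval k := (by positivity : (0 : ℝ) < (k : ℝ) ^ 2).trans_le (sq_le_eigval k)
  have hd : 0 < discEig N k := by linarith
  have hG : 0 < 1 / Real.Gamma (2 - α) := one_div_pos.2 (Real.Gamma_pos_of_pos (by linarith))
  have hle : discEig N k * s ≤ eigval k * s := mul_le_mul_of_nonneg_right h1 hs.le
  have hanti := ml_antitone hα hα1 (by positivity) hle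
  rw [abs_sub_comm, abs_of_nonneg (sub_nonneg.2 hanti)]
  refine (ml_sub_le hα hα1 (by positivity) hle).trans ?_
  rw [div_le_iff₀ (by positivity)]
  have h4 : eigval k ^ 2 ≤ 9 * discEig N k ^ 2 := by
    have := pow_le_pow_left₀ hlam.le h2 2
    linarith
  have h5 : eigval k - discEig N k ≤ 9 * discEig N k ^ 2 / (12 * N ^ 2) :=
    h3.trans (div_le_div_of_nonneg_right h4 (by positivity))
  calc 4 / Real.Gamma (2 - α) * (eigval k * s - discEig N k * s)
      = 4 * (1 / Real.Gamma (2 - α)) * s * (eigval k - discEig N k) := by ring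
    _ ≤ 4 * (1 / Real.Gamma (2 - α)) * s * (9 * discEig N k ^ 2 / (12 * N ^ 2)) :=
        mul_le_mul_of_nonneg_left h5 (by positivity)
    _ = _ := by
        field_simp
        ring

/-! ### Aliasing at the nodes -/

/-- The cosine is a sign depending on `i` and `m` but not on `r`, so it factors out of a whole block
of frequencies. -/
theorem mode_mul_add (N m r : ℕ) (i : Fin (N - 1)) :
    mode N (m * N + r) i = Real.cos (((i + 1) * m : ℕ) * Real.pi) * mode N r i := by
  have hN : (N : ℝ) ≠ 0 := by
    have := i.2
    have : N ≠ 0 := by omega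
    exact_mod_cast this
  rw [mode_eq, mode_eq]
  have e : ((i + 1 : ℕ) : ℝ) * ((m * N + r : ℕ) * Real.pi / N) =
      ((i + 1 : ℕ) : ℝ) * (r * Real.pi / N) + ((i + 1) * m : ℕ) * Real.pi := by
    push_cast
    field_simp
    ring
  rw [e, Real.sin_add, Real.sin_nat_mul_pi]
  ring

theorem mode_zero (N : ℕ) (i : Fin (N - 1)) : mode N 0 i = 0 := by
  simp [mode_eq]

theorem sum_range_mode {N : ℕ} (hN : 0 < N) (B : ℕ → ℝ) (m : ℕ) (i : Fin (N - 1)) :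
    ∑ r ∈ Finset.range N, B r * mode N (m * N + r) i =
      Real.cos (((i + 1) * m : ℕ) * Real.pi) *
        ∑ r : Fin (N - 1), B (r + 1) * mode N (r + 1) i := by
  have e : Finset.range N = Finset.range (N - 1 + 1) := by rw [Nat.sub_add_cancel hN]
  rw [Finset.mul_sum, Fin.sum_univ_eq_sum_range (fun r => Real.cos (((i + 1) * m : ℕ) * Real.pi) *
    (B (r + 1) * mode N (r + 1) i)), e, Finset.sum_range_succ', mode_mul_add, mode_zero]
  simp only [mul_zero, add_zero]
  exact Finset.sum_congr rfl fun r _ => by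
    rw [mode_mul_add]
    ring

/-- Discrete Parseval identity. -/
theorem sum_sq_sum_mode {N : ℕ} (c : Fin (N - 1) → ℝ) :
    ∑ i, (∑ r, c r * mode N (r + 1) i) ^ 2 = N * ∑ r, c r ^ 2 := by
  have e : ∀ i, (∑ r, c r * mode N (r + 1) i) ^ 2 =
      ∑ r, ∑ q, c r * c q * (mode N (r + 1) i * mode N (q + 1) i) := fun i => by
    rw [sq, Finset.sum_mul_sum]
    exact Finset.sum_congr rfl fun r _ => Finset.sum_congr rfl fun q _ => by ring
  simp_rw [e]
  rw [Finset.sum_comm, Finset.mul_sum]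
  refine Finset.sum_congr rfl fun r _ => ?_
  rw [Finset.sum_comm]
  simp_rw [← Finset.mul_sum, sum_mode_mul_mode]
  simp
  ring

/-- Each block of `N` consecutive modes is orthogonal for the discrete inner product. -/
theorem norm_block {N : ℕ} (hN : 0 < N) (B : ℕ → ℝ) (m : ℕ) :
    ‖WithLp.toLp 2 fun i : Fin (N - 1) => ∑ r ∈ Finset.range N, B r * mode N (m * N + r) i‖ =
      Real.sqrt N * Real.sqrt (∑ r : Fin (N - 1), B (r + 1) ^ 2) := by
  rw [EuclideanSpace.norm_eq, ← Real.sqrt_mul (Nat.cast_nonneg N),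
    ← sum_sq_sum_mode (fun r => B (r + 1))]
  congr 1
  refine Finset.sum_congr rfl fun i _ => ?_
  rw [Real.norm_eq_abs, sq_abs]
  change (∑ r ∈ Finset.range N, B r * mode N (m * N + r) i) ^ 2 = _
  rw [sum_range_mode hN, mul_pow]
  have h := Real.cos_sq_add_sin_sq (((i + 1) * m : ℕ) * Real.pi)
  rw [Real.sin_nat_mul_pi] at h
  rw [show Real.cos (((i + 1) * m : ℕ) * Real.pi) ^ 2 = 1 by linarith, one_mul]

theorem sum_range_mul_block (f : ℕ → ℝ) (N M : ℕ) :
    ∑ k ∈ Finset.range (M * N), f k =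
      ∑ m ∈ Finset.range M, ∑ r ∈ Finset.range N, f (m * N + r) := by
  induction M with
  | zero => simp
  | succ M ih => rw [Nat.succ_mul, Finset.sum_range_add, ih, Finset.sum_range_succ]

/-- The aliasing error of a sine series in the discrete `l²` norm. -/
theorem norm_sub_block_le {N : ℕ} (hN : 0 < N) {B : ℕ → ℝ} {v : Fin (N - 1) → ℝ}
    (hv : ∀ i, HasSum (fun k => B k * mode N k i) (v i)) {c : ℕ → ℝ} (hc : Summable c)
    (hBc : ∀ m, Real.sqrt (∑ r : Fin (N - 1), B ((m + 1) * N + (r + 1)) ^ 2) ≤ c m) :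
    ‖WithLp.toLp 2 fun i => v i - ∑ r ∈ Finset.range N, B r * mode N r i‖ ≤
      Real.sqrt N * ∑' m, c m := by
  set β : ℕ → EuclideanSpace ℝ (Fin (N - 1)) := fun m => WithLp.toLp 2 fun i =>
    ∑ r ∈ Finset.range N, B ((m + 1) * N + r) * mode N ((m + 1) * N + r) i with hβ
  have hlim : Tendsto (fun M => ∑ m ∈ Finset.range M, β m) atTop
      (𝓝 (WithLp.toLp 2 fun i => v i - ∑ r ∈ Finset.range N, B r * mode N r i)) := by
    have h1 : Tendsto (fun M => fun i => ∑ m ∈ Finset.range M, β m i) atTop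
        (𝓝 fun i => v i - ∑ r ∈ Finset.range N, B r * mode N r i) := by
      refine tendsto_pi_nhds.2 fun i => ?_
      -- Pass to the partial sums of length `(M + 1) N`, which consist of whole blocks; block `0` is
      -- the one subtracted.
      have h2 : Tendsto (fun M : ℕ => (M + 1) * N) atTop atTop :=
        tendsto_atTop_mono (fun M => (Nat.le_succ M).trans (Nat.le_mul_of_pos_right _ hN))
          tendsto_id
      have h3 := ((hv i).tendsto_sum_nat.comp h2).sub_const
        (∑ r ∈ Finset.range N, B r * mode N r i)
      refine h3.congr fun M => ?_
      simp only [Function.comp_apply, hβ]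
      rw [sum_range_mul_block, Finset.sum_range_succ']
      simp
    have h4 := ((PiLp.continuous_toLp 2 fun _ : Fin (N - 1) => ℝ).tendsto _).comp h1
    refine h4.congr fun M => ?_
    ext i
    simp
  refine le_of_tendsto hlim.norm (Eventually.of_forall fun M => ?_)
  have hc0 : ∀ m, 0 ≤ c m := fun m => (Real.sqrt_nonneg _).trans (hBc m)
  calc ‖∑ m ∈ Finset.range M, β m‖ ≤ ∑ m ∈ Finset.range M, ‖β m‖ := norm_sum_le _ _
    _ ≤ ∑ m ∈ Finset.range M, Real.sqrt N * c m := Finset.sum_le_sum fun m _ => by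
        have h := norm_block hN (fun r => B ((m + 1) * N + r)) (m + 1)
        simp only [hβ]
        rw [h]
        exact mul_le_mul_of_nonneg_left (hBc m) (Real.sqrt_nonneg _)
    _ = Real.sqrt N * ∑ m ∈ Finset.range M, c m := by rw [Finset.mul_sum]
    _ ≤ _ := mul_le_mul_of_nonneg_left (hc.sum_le_tsum _ fun m _ => hc0 m) (Real.sqrt_nonneg _)

/-! ### Power sums and rates in `h` -/

/-- Induction; the step `n^(1-s) ≤ (n+1)^(1-s) - (1-s)(n+1)^(-s)` is Bernoulli's inequality. -/
theorem sum_rpow_neg_le {s : ℝ} (hs0 : 0 ≤ s) (hs : s < 1) (n : ℕ) :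
    ∑ k ∈ Finset.range n, ((k : ℝ) + 1) ^ (-s) ≤ (n : ℝ) ^ (1 - s) / (1 - s) := by
  have h1s : 0 < 1 - s := by linarith
  induction n with
  | zero => simp [Real.zero_rpow h1s.ne']
  | succ n ih =>
    rw [Finset.sum_range_succ]
    have hn : (0 : ℝ) < (n : ℝ) + 1 := by positivity
    have hb := rpow_one_add_le_one_add_mul_self (s := -(1 / ((n : ℝ) + 1))) (p := 1 - s)
      (by rw [neg_le_neg_iff, div_le_one hn]; linarith [(Nat.cast_nonneg n : (0 : ℝ) ≤ n)])
      h1s.le (by linarith)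
    have e1 : (n : ℝ) ^ (1 - s) =
        ((n : ℝ) + 1) ^ (1 - s) * (1 + -(1 / ((n : ℝ) + 1))) ^ (1 - s) := by
      have e : 1 + -(1 / ((n : ℝ) + 1)) = n / (n + 1) := by field_simp; ring
      rw [e, ← Real.mul_rpow hn.le (by positivity), mul_div_cancel₀ _ hn.ne']
    have e2 : ((n : ℝ) + 1) ^ (1 - s) = ((n : ℝ) + 1) ^ (-s) * (n + 1) := by
      rw [show 1 - s = -s + 1 by ring, Real.rpow_add_one hn.ne']
    have h2 := mul_le_mul_of_nonneg_left hb (Real.rpow_nonneg hn.le (1 - s))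
    rw [← e1] at h2
    have h3 : ((n : ℝ) + 1) ^ (1 - s) * (1 + (1 - s) * -(1 / ((n : ℝ) + 1))) =
        ((n : ℝ) + 1) ^ (1 - s) - (1 - s) * ((n : ℝ) + 1) ^ (-s) := by
      rw [e2]
      field_simp
      ring
    rw [h3] at h2
    rw [le_div_iff₀ h1s] at ih ⊢
    push_cast
    linarith

/-- Lets terms without a logarithm be absorbed into the bound: `log N ≥ log 2 > 1/4` makes `ell` at
least `1/2`. -/
theorem one_le_two_mul_ell_rpow {N : ℕ} (hN : 2 ≤ N) (x : ℝ) :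
    1 ≤ 2 * ell (1 / (N : ℝ)) ^ chi0 x := by
  unfold chi0
  split_ifs
  · have h2 : (2 : ℝ) ≤ N := by exact_mod_cast hN
    have hlog : Real.log 2 ≤ Real.log N := Real.log_le_log two_pos h2
    have := Real.log_two_gt_d9
    rw [Real.rpow_one, ell, one_div (N : ℝ), Real.log_inv, abs_neg, abs_of_pos (by linarith),
      ← Real.sqrt_eq_rpow]
    have h3 : Real.sqrt (1 / 4) ≤ Real.sqrt (Real.log N) := Real.sqrt_le_sqrt (by linarith)
    rw [show (1 / 4 : ℝ) = (1 / 2) ^ 2 by norm_num, Real.sqrt_sq (by norm_num)] at h3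
    linarith
  · simp

theorem inv_rpow_sq {x : ℝ} (hx : 0 ≤ x) (σ : ℝ) : (x ^ σ)⁻¹ ^ 2 = x ^ (-(2 * σ)) := by
  rw [← Real.rpow_neg hx, ← Real.rpow_natCast, ← Real.rpow_mul hx]
  congr 1
  push_cast
  ring

/-- The sum coming from the Cauchy-Schwarz inequality for the low modes. -/
theorem exists_sqrt_sum_mul_sq_le {σ : ℝ} (hσ : 0 ≤ σ) :
    ∃ C : ℝ, 0 < C ∧ ∀ N : ℕ, 2 ≤ N →
      Real.sqrt (∑ k : Fin (N - 1), (((k : ℝ) + 1) ^ σ)⁻¹ ^ 2) * (1 / (N : ℝ)) ^ 2 ≤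
        C * (1 / (N : ℝ)) ^ min (σ + 3 / 2) 2 *
          ell (1 / (N : ℝ)) ^ chi0 (1 / 4 - σ / 2) := by
  have hsum : ∀ N : ℕ, ∑ k : Fin (N - 1), (((k : ℝ) + 1) ^ σ)⁻¹ ^ 2 =
      ∑ k ∈ Finset.range (N - 1), ((k : ℝ) + 1) ^ (-(2 * σ)) := fun N => by
    rw [← Fin.sum_univ_eq_sum_range (fun k => ((k : ℝ) + 1) ^ (-(2 * σ)))]
    exact Finset.sum_congr rfl fun k _ => inv_rpow_sq (by positivity) σ
  simp_rw [hsum]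
  -- The sum of `k^(-2σ)` grows like `N^(1-2σ)`, is harmonic, or converges, according as `σ` is
  -- below, at or above `1/2`.
  rcases lt_trichotomy σ (1 / 2) with h | h | h
  · refine ⟨Real.sqrt (1 / (1 - 2 * σ)), Real.sqrt_pos.2 (one_div_pos.2 (by linarith)),
      fun N hN => ?_⟩
    have hN0 : (0 : ℝ) < N := by
      have : 0 < N := by omega
      exact_mod_cast this
    rw [min_eq_left (by linarith), chi0, if_neg (by intro h0; linarith), Real.rpow_zero, mul_one]
    have h1 := sum_rpow_neg_le (s := 2 * σ) (by linarith) (by linarith) (N - 1)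
    have h2 : ((N - 1 : ℕ) : ℝ) ^ (1 - 2 * σ) ≤ (N : ℝ) ^ (1 - 2 * σ) :=
      Real.rpow_le_rpow (Nat.cast_nonneg _) (by exact_mod_cast Nat.sub_le N 1) (by linarith)
    have h3 : Real.sqrt (∑ k ∈ Finset.range (N - 1), ((k : ℝ) + 1) ^ (-(2 * σ))) ≤
        Real.sqrt (1 / (1 - 2 * σ)) * (N : ℝ) ^ (1 / 2 - σ) := by
      have e : (N : ℝ) ^ (1 / 2 - σ) = Real.sqrt ((N : ℝ) ^ (1 - 2 * σ)) := by
        rw [Real.sqrt_eq_rpow, ← Real.rpow_mul hN0.le]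
        congr 1
        ring
      rw [e, ← Real.sqrt_mul (one_div_pos.2 (by linarith)).le]
      refine Real.sqrt_le_sqrt (h1.trans ?_)
      rw [one_div_mul_eq_div]
      exact div_le_div_of_nonneg_right h2 (by linarith)
    calc _ ≤ Real.sqrt (1 / (1 - 2 * σ)) * (N : ℝ) ^ (1 / 2 - σ) * (1 / (N : ℝ)) ^ 2 :=
          mul_le_mul_of_nonneg_right h3 (by positivity)
      _ = _ := by
          rw [mul_assoc]
          congr 1
          rw [one_div (N : ℝ), Real.inv_rpow hN0.le, ← Real.rpow_neg hN0.le, inv_pow,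
            ← Real.rpow_natCast, ← Real.rpow_neg hN0.le, ← Real.rpow_add hN0]
          congr 1
          push_cast
          ring
  · refine ⟨2, two_pos, fun N hN => ?_⟩
    have h2 : (2 : ℝ) ≤ N := by exact_mod_cast hN
    have hlog : Real.log 2 ≤ Real.log N := Real.log_le_log two_pos h2
    have := Real.log_two_gt_d9
    subst h
    rw [min_eq_right (by norm_num), chi0, if_pos (by norm_num), Real.rpow_one, ell,
      one_div (N : ℝ), Real.log_inv, abs_neg, abs_of_pos (by linarith), ← Real.sqrt_eq_rpow,
      Real.rpow_two, mul_right_comm]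
    refine mul_le_mul_of_nonneg_right ?_ (by positivity)
    have e : (2 : ℝ) = Real.sqrt 4 := by
      rw [show (4 : ℝ) = 2 ^ 2 by norm_num, Real.sqrt_sq two_pos.le]
    rw [e, ← Real.sqrt_mul (by norm_num)]
    refine Real.sqrt_le_sqrt ?_
    have h3 : ∑ k ∈ Finset.range (N - 1), ((k : ℝ) + 1) ^ (-(2 * (1 / 2 : ℝ))) =
        (harmonic (N - 1) : ℝ) := by
      rw [harmonic]
      push_cast
      exact Finset.sum_congr rfl fun k _ => by
        rw [show -(2 * (1 / 2 : ℝ)) = -1 by norm_num, Real.rpow_neg_one]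
    have hs4 : Real.sqrt 4 = 2 := e.symm
    have h4 := harmonic_le_one_add_log (N - 1)
    have h5 : Real.log ((N - 1 : ℕ) : ℝ) ≤ Real.log N := by
      have h6 : 0 < N - 1 := by omega
      refine Real.log_le_log (by exact_mod_cast h6) (by exact_mod_cast Nat.sub_le N 1)
    simp only [hs4] at *
    rw [h3]
    linarith
  · have hsm : Summable fun k : ℕ => ((k : ℝ) + 1) ^ (-(2 * σ)) := by
      have := (summable_nat_add_iff 1).2 (Real.summable_nat_rpow (p := -(2 * σ)).2 (by linarith))
      simpa using this
    have hnn : ∀ k : ℕ, 0 ≤ ((k : ℝ) + 1) ^ (-(2 * σ)) := fun k =>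
      Real.rpow_nonneg (by positivity) _
    refine ⟨Real.sqrt (∑' k : ℕ, ((k : ℝ) + 1) ^ (-(2 * σ))) + 1, by positivity, fun N hN => ?_⟩
    rw [min_eq_right (by linarith), chi0, if_neg (by intro h0; linarith), Real.rpow_zero, mul_one,
      Real.rpow_two]
    refine mul_le_mul_of_nonneg_right ?_ (by positivity)
    have := Real.sqrt_le_sqrt (hsm.sum_le_tsum (Finset.range (N - 1)) fun k _ => hnn k)
    linarith

/-! ### Coefficient bounds from the norm of the initial value -/

theorem hhatNorm_nonneg (σ : ℝ) (v : ℝ → ℝ) : 0 ≤ hhatNorm σ v := Real.sqrt_nonneg _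

theorem InHhat.sum_le {σ : ℝ} {v : ℝ → ℝ} (hv : InHhat σ v) (p n : ℕ) :
    ∑ r : Fin n, eigval (p + (r + 1)) ^ σ * pairing v (eigfun (p + (r + 1))) ^ 2 ≤
      hhatNorm σ v ^ 2 := by
  have hnn : ∀ k : ℕ, 0 ≤ eigval (k + 1) ^ σ * pairing v (eigfun (k + 1)) ^ 2 := fun k =>
    mul_nonneg (Real.rpow_nonneg (by unfold eigval; positivity) _) (sq_nonneg _)
  rw [hhatNorm, Real.sq_sqrt (tsum_nonneg hnn), Fin.sum_univ_eq_sum_range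
    (fun r => eigval (p + (r + 1)) ^ σ * pairing v (eigfun (p + (r + 1))) ^ 2)]
  have h := hv.2.sum_le_tsum (Finset.Ico p (p + n)) fun k _ => hnn k
  rw [Finset.sum_Ico_eq_sum_range, Nat.add_sub_cancel_left] at h
  exact h

/-- A weighted `ℓ²` bound for a finite range of coefficients, from the `Ĥ^σ` norm. -/
theorem InHhat.sqrt_sum_sq_le {σ : ℝ} {v : ℝ → ℝ} (hσ : 0 ≤ σ) (hv : InHhat σ v) {p n : ℕ}
    {c q : ℝ} (hc : 0 ≤ c) (hq : 0 < q) (hqp : q ≤ p + 1) {B : ℕ → ℝ}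
    (hB : ∀ r < n, |B r| ≤ c * |pairing v (eigfun (p + (r + 1)))|) :
    Real.sqrt (∑ r : Fin n, B r ^ 2) ≤ c / q ^ σ * hhatNorm σ v := by
  have hqσ : 0 < q ^ σ := Real.rpow_pos_of_pos hq σ
  have hH := hhatNorm_nonneg σ v
  refine Real.sqrt_le_iff.2 ⟨by positivity, ?_⟩
  rw [mul_pow]
  refine le_trans ?_ (mul_le_mul_of_nonneg_left (hv.sum_le p n) (sq_nonneg _))
  rw [Finset.mul_sum]
  refine Finset.sum_le_sum fun r _ => ?_
  have h1 : B r ^ 2 ≤ (c * |pairing v (eigfun (p + (r + 1)))|) ^ 2 :=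
    sq_le_sq' (by linarith [(abs_le.1 (hB r r.2)).1]) ((le_abs_self _).trans (hB r r.2))
  rw [mul_pow, sq_abs] at h1
  -- Every frequency in the range is at least `q`, and `λ_k ≥ k²`.
  have h2 : (q ^ σ) ^ 2 ≤ eigval (p + (r + 1)) ^ σ := by
    rw [← Real.rpow_natCast, ← Real.rpow_mul hq.le, mul_comm σ, Real.rpow_mul hq.le]
    refine Real.rpow_le_rpow (by positivity) ?_ hσ
    rw [Real.rpow_natCast]
    refine le_trans (pow_le_pow_left₀ hq.le ?_ 2) (sq_le_eigval _)
    push_cast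
    linarith [(Nat.cast_nonneg (r : ℕ) : (0 : ℝ) ≤ (r : ℕ))]
  refine h1.trans ?_
  rw [← mul_assoc]
  refine mul_le_mul_of_nonneg_right ?_ (sq_nonneg _)
  rw [div_pow, div_mul_eq_mul_div, le_div_iff₀ (by positivity)]
  exact mul_le_mul_of_nonneg_left h2 (sq_nonneg c)

/-! ### Low-mode and high-mode error -/

/-- The coefficients of the error in the sine basis. -/
noncomputable def errCoef (α : ℝ) (u₀ : ℝ → ℝ) (N : ℕ) (t : ℝ) (k : ℕ) : ℝ :=
  pairing u₀ (eigfun k) * ml α (eigval k * t ^ α) -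
    if k < N then pairing u₀ (eigfun k) * ml α (discEig N k * t ^ α) else 0

/-- Smoothing at positive time gains two powers of the frequency. The lower bound `q` may be `k`
itself or a bound common to a block. -/
theorem abs_mul_ml_le {α s : ℝ} (hα : 0 < α) (hα1 : α < 1) (hs : 0 < s) {q : ℝ} (hq : 0 < q)
    {k : ℕ} (hk : q ≤ k) (a : ℝ) :
    |a * ml α (eigval k * s)| ≤ 1 / Real.Gamma (2 - α) * s⁻¹ / q ^ 2 * |a| := by
  have hG : 0 < 1 / Real.Gamma (2 - α) := one_div_pos.2 (Real.Gamma_pos_of_pos (by linarith))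
  have h1 : q ^ 2 ≤ eigval k := (pow_le_pow_left₀ hq.le hk 2).trans (sq_le_eigval k)
  have h2 : 0 < eigval k := (by positivity : 0 < q ^ 2).trans_le h1
  rw [abs_mul, mul_comm, abs_of_nonneg (ml_nonneg hα hα1 (by positivity))]
  refine mul_le_mul_of_nonneg_right ((ml_le_div hα hα1 (by positivity)).trans ?_) (abs_nonneg a)
  have e : 1 / Real.Gamma (2 - α) * s⁻¹ / q ^ 2 = 1 / Real.Gamma (2 - α) / (q ^ 2 * s) := by
    field_simp
  rw [e]
  refine div_le_div_of_nonneg_left hG.le (by positivity) ?_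
  exact mul_le_mul_of_nonneg_right h1 hs.le

/-- For `t > 0` the coefficients of `u(t)` are `O(k^{-2})` even when `σ = 0`, so the sine series
converges to the nodal values. -/
theorem hasSum_errCoef {α T σ : ℝ} (hα : 0 < α) (hα1 : α < 1) (hσ : 0 ≤ σ) {u₀ : ℝ → ℝ}
    {u : ℝ → ℝ → ℝ} {N : ℕ} {U : ℝ → Fin (N - 1) → ℝ} (hT : 0 < T) (hu₀ : InHhat σ u₀)
    (hu : IsSolution α T u₀ (fun _ _ => 0) u)
    (hU : IsModifiedSchemeSolution α T N u₀ (fun _ _ => 0) U) {t : ℝ} (ht : t ∈ Ioc 0 T)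
    (i : Fin (N - 1)) :
    HasSum (fun k => errCoef α u₀ N t k * mode N k i) ((nodal N (u t) - U t) i) := by
  have ht' := Ioc_subset_Icc_self ht
  have htα : 0 < t ^ α := Real.rpow_pos_of_pos ht.1 α
  have hN : 0 < N := by have := i.2; omega
  have hN' : (0 : ℝ) < N := by exact_mod_cast hN
  have hsum : Summable fun k : ℕ => pairing (u t) (eigfun (k + 1)) := by
    have hb : Summable fun k : ℕ => 1 / Real.Gamma (2 - α) * (t ^ α)⁻¹ * hhatNorm σ u₀ *
        (1 / (((k + 1 : ℕ) : ℝ)) ^ 2) := by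
      refine Summable.mul_left _ ?_
      exact (summable_nat_add_iff 1).2 (Real.summable_one_div_nat_pow.2 one_lt_two)
    refine Summable.of_norm_bounded hb fun k => ?_
    rw [hu.pairing_eq hα hα1 hT hu₀.1 (k + 1) ht']
    have h1 := abs_mul_ml_le hα hα1 htα (q := ((k + 1 : ℕ) : ℝ)) (by positivity) le_rfl
      (pairing u₀ (eigfun (k + 1)))
    have h2 := hu₀.sqrt_sum_sq_le hσ (p := k) (n := 1) (c := 1) (q := 1) zero_le_one one_pos
      (by simp) (B := fun r => pairing u₀ (eigfun (k + (r + 1)))) (fun r _ => by rw [one_mul])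
    simp only [Finset.univ_unique, Fin.default_eq_zero, Fin.val_zero, zero_add,
      Finset.sum_singleton, Real.sqrt_sq_eq_abs, Real.one_rpow, div_one, one_mul] at h2
    have hG : 0 < 1 / Real.Gamma (2 - α) := one_div_pos.2 (Real.Gamma_pos_of_pos (by linarith))
    refine h1.trans ((mul_le_mul_of_nonneg_left h2 (by positivity)).trans_eq ?_)
    ring
  have hx : (((i : ℕ) + 1 : ℝ) / (N : ℝ)) ∈ Icc (0 : ℝ) 1 := by
    refine ⟨by positivity, (div_le_one hN').2 ?_⟩
    have : (i : ℕ) + 1 ≤ N := by have := i.2; omega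
    exact_mod_cast this
  have hS := hasSum_eigfun_of_summable (hu.continuous_space t ht) (hu.boundary t ht).1
    (hu.boundary t ht).2 hsum hx
  have hS' : HasSum (fun k => pairing u₀ (eigfun k) * ml α (eigval k * t ^ α) * mode N k i)
      (nodal N (u t) i) := by
    rw [← hasSum_nat_add_iff' 1]
    simp only [Finset.range_one, Finset.sum_singleton, mode_zero, mul_zero, sub_zero]
    refine (hasSum_congr fun k => ?_).1 hS
    rw [hu.pairing_eq hα hα1 hT hu₀.1 (k + 1) ht']
    rfl
  have hUs : HasSum (fun k => (if k < N then pairing u₀ (eigfun k) *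
      ml α (discEig N k * t ^ α) else 0) * mode N k i) (U t i) := by
    have h1 : U t i = ∑ k ∈ Finset.range N, (if k < N then pairing u₀ (eigfun k) *
        ml α (discEig N k * t ^ α) else 0) * mode N k i := ?_
    · rw [h1]
      exact hasSum_sum_of_ne_finset_zero fun k hk => by
        rw [if_neg (by simpa using hk), zero_mul]
    rw [hU.eq_sum hα hα1 hT ht' i, Fin.sum_univ_eq_sum_range (fun k => pairing u₀ (eigfun (k + 1)) *
      ml α (discEig N (k + 1) * t ^ α) * mode N (k + 1) i),
      show Finset.range N = Finset.range (N - 1 + 1) by rw [Nat.sub_add_cancel hN],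
      Finset.sum_range_succ', mode_zero, mul_zero, add_zero]
    refine Finset.sum_congr rfl fun k hk => ?_
    rw [Finset.mem_range] at hk
    rw [if_pos (by omega)]
  refine (hasSum_congr fun k => ?_).1 (hS'.sub hUs)
  rw [errCoef]
  ring

theorem abs_errCoef_le {α t : ℝ} (hα : 0 < α) (hα1 : α < 1) (ht : 0 < t) (u₀ : ℝ → ℝ) {N k : ℕ}
    (hk : 0 < k) (hkN : k < N) :
    |errCoef α u₀ N t k| ≤ 3 * (1 / Real.Gamma (2 - α)) / (N : ℝ) ^ 2 * (t ^ α)⁻¹ *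
      |pairing u₀ (eigfun k)| := by
  rw [errCoef, if_pos hkN, ← mul_sub, abs_mul, mul_comm]
  exact mul_le_mul_of_nonneg_right
    (abs_ml_sub_ml_discEig_le hα hα1 (Real.rpow_pos_of_pos ht α) hk hkN.le) (abs_nonneg _)

/-- The contribution of the high modes to the error. -/
theorem norm_tail_le {α σ t : ℝ} (hα : 0 < α) (hα1 : α < 1) (hσ : 0 ≤ σ) (ht : 0 < t)
    {u₀ : ℝ → ℝ} (hu₀ : InHhat σ u₀) {N : ℕ} (hN : 0 < N) {v : Fin (N - 1) → ℝ}
    (hv : ∀ i, HasSum (fun k => errCoef α u₀ N t k * mode N k i) (v i)) :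
    ‖WithLp.toLp 2 fun i => v i - ∑ r ∈ Finset.range N, errCoef α u₀ N t r * mode N r i‖ ≤
      Real.sqrt N * (1 / Real.Gamma (2 - α) * (t ^ α)⁻¹ / (N : ℝ) ^ 2 / (N : ℝ) ^ σ *
        hhatNorm σ u₀ * ∑' m : ℕ, 1 / ((m + 1 : ℕ) : ℝ) ^ 2) := by
  have hN' : (0 : ℝ) < N := by exact_mod_cast hN
  have htα : 0 < t ^ α := Real.rpow_pos_of_pos ht α
  have hG : 0 < 1 / Real.Gamma (2 - α) := one_div_pos.2 (Real.Gamma_pos_of_pos (by linarith))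
  rw [← tsum_mul_left]
  refine norm_sub_block_le hN hv (((summable_nat_add_iff 1).2
    (Real.summable_one_div_nat_pow.2 one_lt_two)).mul_left _) fun m => ?_
  -- Two lower bounds on the frequency are used: `q = (m+1)N` in the decay of `E_α`, for summability
  -- in `m`, and just `N` in the weight of the norm.
  set q : ℝ := (m + 1 : ℕ) * (N : ℝ) with hq
  have hq0 : 0 < q := by positivity
  have hNq : (N : ℝ) ≤ q := by
    rw [hq]
    push_cast
    nlinarith [(Nat.cast_nonneg m : (0 : ℝ) ≤ m)]
  refine (hu₀.sqrt_sum_sq_le hσ (p := (m + 1) * N) (n := N - 1)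
    (c := 1 / Real.Gamma (2 - α) * (t ^ α)⁻¹ / q ^ 2) (q := N) (by positivity) hN'
    (by push_cast [hq] at hNq ⊢; linarith)
    (B := fun r => errCoef α u₀ N t ((m + 1) * N + (r + 1))) fun r _ => ?_).trans_eq ?_
  · rw [errCoef, if_neg (by nlinarith), sub_zero]
    refine abs_mul_ml_le hα hα1 htα hq0 ?_ _
    rw [hq]
    push_cast
    linarith [(Nat.cast_nonneg r : (0 : ℝ) ≤ r)]
  · rw [hq, mul_pow]
    field_simp

theorem lInfNorm_le {n : ℕ} {v : Fin n → ℝ} {C : ℝ} (hC : 0 ≤ C) (h : ∀ i, |v i| ≤ C) :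
    lInfNorm v ≤ C := Real.iSup_le h hC

theorem l2Norm_eq {n : ℕ} (v : Fin n → ℝ) :
    l2Norm v = Real.sqrt (1 / (n : ℝ)) * ‖WithLp.toLp 2 v‖ := by
  rw [l2Norm, EuclideanSpace.norm_eq, Real.sqrt_mul (by positivity)]
  simp only [Real.norm_eq_abs, sq_abs]

/-- The left side is exactly `h^(σ + 3/2)`. -/
theorem sqrt_mul_rpow_bound {σ : ℝ} {N : ℕ} (hN : 2 ≤ N) :
    Real.sqrt N * (1 / (N : ℝ) ^ 2 / (N : ℝ) ^ σ) ≤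
      2 * ((1 / (N : ℝ)) ^ min (σ + 3 / 2) 2 * ell (1 / (N : ℝ)) ^ chi0 (1 / 4 - σ / 2)) := by
  have hN0 : (0 : ℝ) < N := by
    have : 0 < N := by omega
    exact_mod_cast this
  have hN1 : (1 : ℝ) ≤ N := by
    have : 1 ≤ N := by omega
    exact_mod_cast this
  have e : Real.sqrt N * (1 / (N : ℝ) ^ 2 / (N : ℝ) ^ σ) = (1 / (N : ℝ)) ^ (σ + 3 / 2) := by
    have e1 : 1 / (N : ℝ) ^ 2 / (N : ℝ) ^ σ = (N : ℝ) ^ (-(2 + σ)) := by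
      rw [Real.rpow_neg hN0.le, Real.rpow_add hN0, Real.rpow_two, div_div, one_div]
    rw [e1, Real.sqrt_eq_rpow, ← Real.rpow_add hN0, one_div (N : ℝ), Real.inv_rpow hN0.le,
      ← Real.rpow_neg hN0.le]
    congr 1
    ring
  rw [e]
  have h1 : (1 / (N : ℝ)) ^ (σ + 3 / 2) ≤ (1 / (N : ℝ)) ^ min (σ + 3 / 2) 2 :=
    Real.rpow_le_rpow_of_exponent_ge (by positivity) ((div_le_one hN0).2 hN1) (min_le_left _ _)
  have h2 := one_le_two_mul_ell_rpow hN (1 / 4 - σ / 2)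
  have h3 : 0 ≤ (1 / (N : ℝ)) ^ min (σ + 3 / 2) 2 := Real.rpow_nonneg (by positivity) _
  nlinarith

/-- The contribution of the low modes to the error in the maximum norm. -/
theorem abs_low_le {α σ t : ℝ} (hα : 0 < α) (hα1 : α < 1) (hσ : 0 ≤ σ) (ht : 0 < t)
    {u₀ : ℝ → ℝ} (hu₀ : InHhat σ u₀) {N : ℕ} (hN : 0 < N) (i : Fin (N - 1)) :
    |∑ r ∈ Finset.range N, errCoef α u₀ N t r * mode N r i| ≤
      Real.sqrt 2 * (3 * (1 / Real.Gamma (2 - α)) / (N : ℝ) ^ 2 * (t ^ α)⁻¹) *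
        (Real.sqrt (∑ k : Fin (N - 1), (((k : ℝ) + 1) ^ σ)⁻¹ ^ 2) * hhatNorm σ u₀) := by
  have htα : 0 < t ^ α := Real.rpow_pos_of_pos ht α
  have hG : 0 < 1 / Real.Gamma (2 - α) := one_div_pos.2 (Real.Gamma_pos_of_pos (by linarith))
  set c := 3 * (1 / Real.Gamma (2 - α)) / (N : ℝ) ^ 2 * (t ^ α)⁻¹ with hc
  have hc0 : 0 ≤ c := by positivity
  have hcs : ∑ r : Fin (N - 1), |pairing u₀ (eigfun (r + 1))| ≤
      Real.sqrt (∑ k : Fin (N - 1), (((k : ℝ) + 1) ^ σ)⁻¹ ^ 2) * hhatNorm σ u₀ := by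
    -- Cauchy-Schwarz with the weights `k^σ ≤ λ_k^(σ/2)`.
    have h1 := Real.sum_mul_le_sqrt_mul_sqrt Finset.univ
      (fun k : Fin (N - 1) => (((k : ℝ) + 1) ^ σ)⁻¹)
      (fun k => ((k : ℝ) + 1) ^ σ * |pairing u₀ (eigfun (k + 1))|)
    have h2 : ∀ k : Fin (N - 1), (((k : ℝ) + 1) ^ σ)⁻¹ *
        (((k : ℝ) + 1) ^ σ * |pairing u₀ (eigfun (k + 1))|) = |pairing u₀ (eigfun (k + 1))| :=
      fun k => inv_mul_cancel_left₀ (Real.rpow_pos_of_pos (by positivity) σ).ne' _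
    simp_rw [h2] at h1
    refine h1.trans (mul_le_mul_of_nonneg_left ?_ (Real.sqrt_nonneg _))
    refine Real.sqrt_le_iff.2 ⟨hhatNorm_nonneg _ _, ?_⟩
    refine le_trans (Finset.sum_le_sum fun r _ => ?_) (hu₀.sum_le 0 (N - 1))
    rw [mul_pow, sq_abs, zero_add]
    refine mul_le_mul_of_nonneg_right ?_ (sq_nonneg _)
    have hr : (0 : ℝ) ≤ (r : ℝ) + 1 := by positivity
    rw [← Real.rpow_natCast, ← Real.rpow_mul hr, mul_comm σ, Real.rpow_mul hr, Real.rpow_natCast]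
    refine Real.rpow_le_rpow (by positivity) ?_ hσ
    have := sq_le_eigval ((r : ℕ) + 1)
    push_cast at this
    exact this
  have e : ∑ r ∈ Finset.range N, errCoef α u₀ N t r * mode N r i =
      ∑ r : Fin (N - 1), errCoef α u₀ N t (r + 1) * mode N (r + 1) i := by
    rw [Fin.sum_univ_eq_sum_range (fun r => errCoef α u₀ N t (r + 1) * mode N (r + 1) i),
      show Finset.range N = Finset.range (N - 1 + 1) by rw [Nat.sub_add_cancel hN],
      Finset.sum_range_succ', mode_zero, mul_zero, add_zero]
  rw [e]
  calc _ ≤ ∑ r : Fin (N - 1), |errCoef α u₀ N t (r + 1) * mode N (r + 1) i| :=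
        Finset.abs_sum_le_sum_abs _ _
    _ ≤ ∑ r : Fin (N - 1), Real.sqrt 2 * c * |pairing u₀ (eigfun (r + 1))| := by
        refine Finset.sum_le_sum fun r _ => ?_
        rw [abs_mul, mul_comm, mul_assoc]
        exact mul_le_mul (abs_eigfun_le _ _)
          (abs_errCoef_le hα hα1 ht u₀ (by omega) (by omega)) (abs_nonneg _) (Real.sqrt_nonneg _)
    _ ≤ _ := by
        rw [← Finset.mul_sum]
        exact mul_le_mul_of_nonneg_left hcs (by positivity)

/-- The contribution of the low modes to the error in the Euclidean norm. -/
theorem norm_low_le {α σ t : ℝ} (hα : 0 < α) (hα1 : α < 1) (hσ : 0 ≤ σ) (ht : 0 < t)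
    {u₀ : ℝ → ℝ} (hu₀ : InHhat σ u₀) {N : ℕ} (hN : 0 < N) :
    ‖WithLp.toLp 2 fun i : Fin (N - 1) =>
        ∑ r ∈ Finset.range N, errCoef α u₀ N t r * mode N r i‖ ≤
      Real.sqrt N * (3 * (1 / Real.Gamma (2 - α)) / (N : ℝ) ^ 2 * (t ^ α)⁻¹ * hhatNorm σ u₀) := by
  have htα : 0 < t ^ α := Real.rpow_pos_of_pos ht α
  have hG : 0 < 1 / Real.Gamma (2 - α) := one_div_pos.2 (Real.Gamma_pos_of_pos (by linarith))
  -- The low modes are the block `m = 0`.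
  have h1 := norm_block hN (errCoef α u₀ N t) 0
  simp only [zero_mul, zero_add] at h1
  rw [h1]
  refine mul_le_mul_of_nonneg_left ?_ (Real.sqrt_nonneg _)
  have h2 := hu₀.sqrt_sum_sq_le hσ (p := 0) (n := N - 1)
    (c := 3 * (1 / Real.Gamma (2 - α)) / (N : ℝ) ^ 2 * (t ^ α)⁻¹) (q := 1)
    (by positivity) one_pos (by simp) (B := fun r => errCoef α u₀ N t (r + 1)) (fun r hr => by
      rw [zero_add]
      exact abs_errCoef_le hα hα1 ht u₀ (by omega) (by omega))
  rwa [Real.one_rpow, div_one] at h2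

end FracDiff

/-! ### The error estimate -/

theorem mainTheorem3 (α σ : ℝ) (hα : α ∈ Set.Ioo (0 : ℝ) 1) (hσ : 0 ≤ σ) :
    ∃ C : ℝ, 0 < C ∧
      ∀ (T : ℝ) (u₀ : ℝ → ℝ) (u : ℝ → ℝ → ℝ) (N : ℕ) (U : ℝ → Fin (N - 1) → ℝ) (h : ℝ),
        0 < T → 2 ≤ N → h = 1 / (N : ℝ) →
        InHhat σ u₀ →
        IsSolution α T u₀ (fun _ _ => 0) u →
        IsModifiedSchemeSolution α T N u₀ (fun _ _ => 0) U →
        ∀ t ∈ Set.Ioc 0 T,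
          lInfNorm (nodal N (u t) - U t) ≤
              C * h ^ min (σ + 3 / 2) 2 * ell h ^ chi0 (1 / 4 - σ / 2) * t ^ (-α) * hhatNorm σ u₀ ∧
          l2Norm (nodal N (u t) - U t) ≤ C * h ^ 2 * t ^ (-α) * hhatNorm σ u₀ := by
  obtain ⟨hα0, hα1⟩ := hα
  have hG : 0 < 1 / Real.Gamma (2 - α) := one_div_pos.2 (Real.Gamma_pos_of_pos (by linarith))
  set K := 1 / Real.Gamma (2 - α) with hK
  set Z : ℝ := ∑' m : ℕ, 1 / ((m + 1 : ℕ) : ℝ) ^ 2 with hZ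
  have hZ0 : 0 ≤ Z := tsum_nonneg fun m => by positivity
  obtain ⟨C₀, hC₀, hlow⟩ := exists_sqrt_sum_mul_sq_le hσ
  -- The first two summands serve the low and high modes in the maximum norm, the third the `l²`
  -- bound.
  refine ⟨Real.sqrt 2 * (3 * K) * C₀ + 2 * K * Z + 2 * (3 * K + K * Z), by positivity, ?_⟩
  intro T u₀ u N U h hT hN hh hu₀ hu hU t ht
  subst hh
  have hNpos : 0 < N := by omega
  have hN0 : (0 : ℝ) < N := by exact_mod_cast hNpos
  have htα : 0 < t ^ α := Real.rpow_pos_of_pos ht.1 α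
  have hH := hhatNorm_nonneg σ u₀
  have hv := hasSum_errCoef hα0 hα1 hσ hT hu₀ hu hU ht
  have htail := norm_tail_le hα0 hα1 hσ ht.1 hu₀ hNpos hv
  have hlow2 := norm_low_le hα0 hα1 hσ ht.1 hu₀ hNpos
  rw [← hK] at htail hlow2
  rw [← hZ] at htail
  rw [Real.rpow_neg ht.1.le]
  set v := nodal N (u t) - U t with hvdef
  set low : Fin (N - 1) → ℝ := fun i =>
    ∑ r ∈ Finset.range N, errCoef α u₀ N t r * mode N r i with hlowdef
  set H := hhatNorm σ u₀
  constructor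
  · set X := (1 / (N : ℝ)) ^ min (σ + 3 / 2) 2 * ell (1 / (N : ℝ)) ^ chi0 (1 / 4 - σ / 2) with hX
    have hX0 : 0 ≤ X := mul_nonneg (Real.rpow_nonneg (by positivity) _)
      (Real.rpow_nonneg (Real.rpow_nonneg (abs_nonneg _) _) _)
    have goal_eq : ∀ C : ℝ, C * (1 / (N : ℝ)) ^ min (σ + 3 / 2) 2 *
        ell (1 / (N : ℝ)) ^ chi0 (1 / 4 - σ / 2) * (t ^ α)⁻¹ * H = C * (X * ((t ^ α)⁻¹ * H)) :=
      fun C => by rw [hX]; ring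
    rw [goal_eq]
    refine lInfNorm_le (by positivity) fun i => ?_
    have h1 : |v i - low i| ≤ 2 * K * Z * (X * ((t ^ α)⁻¹ * H)) := by
      -- A single component is bounded by the Euclidean norm; the factor `√N` costs half a power of
      -- `h`, which the high modes can afford.
      have h2 := PiLp.norm_apply_le (WithLp.toLp 2 fun i => v i - low i) i
      refine (h2.trans htail).trans ?_
      have h3 := mul_le_mul_of_nonneg_right (sqrt_mul_rpow_bound (σ := σ) hN)
        (by positivity : 0 ≤ K * Z * ((t ^ α)⁻¹ * H))
      rw [← hX] at h3
      calc _ = Real.sqrt N * (1 / (N : ℝ) ^ 2 / (N : ℝ) ^ σ) * (K * Z * ((t ^ α)⁻¹ * H)) := by ring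
        _ ≤ _ := h3
        _ = _ := by ring
    have h4 : |low i| ≤ Real.sqrt 2 * (3 * K) * C₀ * (X * ((t ^ α)⁻¹ * H)) := by
      refine (abs_low_le hα0 hα1 hσ ht.1 hu₀ hNpos i).trans ?_
      have h3 := mul_le_mul_of_nonneg_right (hlow N hN)
        (by positivity : 0 ≤ Real.sqrt 2 * (3 * K) * ((t ^ α)⁻¹ * H))
      calc _ = Real.sqrt (∑ k : Fin (N - 1), (((k : ℝ) + 1) ^ σ)⁻¹ ^ 2) * (1 / (N : ℝ)) ^ 2 *
            (Real.sqrt 2 * (3 * K) * ((t ^ α)⁻¹ * H)) := by ring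
        _ ≤ _ := h3
        _ = _ := by rw [hX]; ring
    have h5 : |v i| ≤ |v i - low i| + |low i| := by
      simpa using abs_add_le (v i - low i) (low i)
    have h6 : 0 ≤ 2 * (3 * K + K * Z) * (X * ((t ^ α)⁻¹ * H)) := by positivity
    linarith
  · have h1 : ‖WithLp.toLp 2 v‖ ≤
        Real.sqrt N * ((3 * K + K * Z) * ((1 / (N : ℝ)) ^ 2 * (t ^ α)⁻¹ * H)) := by
      have e : WithLp.toLp 2 v = WithLp.toLp 2 (fun i => v i - low i) + WithLp.toLp 2 low := by
        ext i
        simp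
      have hN1 : (1 : ℝ) ≤ (N : ℝ) ^ σ := Real.one_le_rpow (by exact_mod_cast hNpos) hσ
      have h2 : K * (t ^ α)⁻¹ / (N : ℝ) ^ 2 / (N : ℝ) ^ σ ≤ K * (t ^ α)⁻¹ / (N : ℝ) ^ 2 :=
        div_le_self (by positivity) hN1
      have h3 : Real.sqrt N * (K * (t ^ α)⁻¹ / (N : ℝ) ^ 2 / (N : ℝ) ^ σ * H * Z) ≤
          Real.sqrt N * (K * (t ^ α)⁻¹ / (N : ℝ) ^ 2 * H * Z) := by gcongr
      rw [e]
      refine (norm_add_le _ _).trans ((add_le_add (htail.trans h3) hlow2).trans_eq ?_)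
      ring
    rw [l2Norm_eq]
    -- The norm averages over `N - 1` nodes while orthogonality produces `N`; the quotient is at
    -- most `2` for `N ≥ 2`.
    have h2 : Real.sqrt (1 / ((N - 1 : ℕ) : ℝ)) * Real.sqrt N ≤ 2 := by
      rw [← Real.sqrt_mul (by positivity)]
      refine Real.sqrt_le_iff.2 ⟨two_pos.le, ?_⟩
      have h3 : 2 * (1 : ℝ) ≤ N := by
        rw [mul_one]
        exact_mod_cast hN
      rw [Nat.cast_sub (by omega), Nat.cast_one, one_div_mul_eq_div, div_le_iff₀ (by linarith)]
      linarith
    calc _ ≤ Real.sqrt (1 / ((N - 1 : ℕ) : ℝ)) *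
          (Real.sqrt N * ((3 * K + K * Z) * ((1 / (N : ℝ)) ^ 2 * (t ^ α)⁻¹ * H))) :=
          mul_le_mul_of_nonneg_left h1 (Real.sqrt_nonneg _)
      _ = Real.sqrt (1 / ((N - 1 : ℕ) : ℝ)) * Real.sqrt N *
          ((3 * K + K * Z) * ((1 / (N : ℝ)) ^ 2 * (t ^ α)⁻¹ * H)) := by ring
      _ ≤ 2 * ((3 * K + K * Z) * ((1 / (N : ℝ)) ^ 2 * (t ^ α)⁻¹ * H)) :=
          mul_le_mul_of_nonneg_right h2 (by positivity)
      _ ≤ _ := by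
          have h6 : 0 ≤ (Real.sqrt 2 * (3 * K) * C₀ + 2 * K * Z) *
              ((1 / (N : ℝ)) ^ 2 * (t ^ α)⁻¹ * H) := by positivity
          linarith
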